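/- Let $\phi(x)=\dfrac{1+3x^2}{1-4x-x^2}\in\mathbb{Q}(x)$, regarded as a map $\mathbb{P}^1(\overline{\mathbb{Q}})\to\mathbb{P}^1(\overline{\mathbb{Q}})$, and let $\alpha=0$. For $n\ge 0$ let $V_n=\phi^{-n}(0)\subset\mathbb{P}^1(\overline{\mathbb{Q}})$ be the set of points $\beta$ with $\phi^n(\beta)=0$, and let $T_\alpha$ be the graph with vertex set $\bigcup_{n\ge 0}V_n$ in which $\beta\neq\gamma$ are joined by an edge if and only if $\phi(\beta)=\gamma$ or $\phi(\gamma)=\beta$, with root $0$. Let $\operatorname{Aut}(T_\alpha)$ be the group of graph automorphisms of $T_\alpha$ fixing the root, let $\rho:\operatorname{Gal}(\overline{\mathbb{Q}}/\mathbb{Q})\to\operatorname{Aut}(T_\alpha)$ be the homomorphism given by the natural action on the vertices, and let $G_\infty$ be the image of $\rho$. Then: (i) $\phi$ is not conjugate to a polynomial by any element of $\mathrm{PGL}_2(\overline{\mathbb{Q}})$; (ii) $T_\alpha$ is the complete binary rooted tree: it is a tree, and every vertex has exactly two preimages under $\phi$; (iii) $\rho$ is surjective, that is, $G_\infty=\operatorname{Aut}(T_\alpha)$.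 -/

import Mathlib

open scoped OnePoint

noncomputable section

namespace Arboreal

open Polynomial

/-- The degree of a rational function in lowest terms, `max (deg num) (deg denom)`. -/
def ratDegree {K : Type*} [Field K] (φ : RatFunc K) : ℕ :=
  max φ.num.natDegree φ.denom.natDegree

open Classical in
/-- The self-map of the projective line `ℙ¹(L) = L ∪ {∞}` induced by a rational function
`φ ∈ K(x)`, for a field extension `L / K`. The numerator and denominator of a `RatFunc` are
coprime, so a zero of the denominator is a pole; the value at `∞` is the ratio of the
coefficients of degree `ratDegree φ`. -/
def ratMap {K : Type*} (L : Type*) [Field K] [Field L] [Algebra K L] (φ : RatFunc K) :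
    OnePoint L → OnePoint L
  | ∞ =>
      if φ.denom.coeff (ratDegree φ) = 0 then ∞
      else ((algebraMap K L (φ.num.coeff (ratDegree φ) / φ.denom.coeff (ratDegree φ)) : L) :
        OnePoint L)
  | (x : L) =>
      if aeval x φ.denom = 0 then ∞ else ((aeval x φ.num / aeval x φ.denom : L) : OnePoint L)

open Classical in
/-- `φ ∈ K(x)` is conjugate to a polynomial: some change of coordinate of `ℙ¹` defined over
the algebraic closure of `K` turns `φ` into a polynomial map. (Over an infinite field a
rational function is determined by the map that it induces on `ℙ¹`.) -/
def IsConjToPolynomial {K : Type*} [Field K] (φ : RatFunc K) : Prop :=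
  ∃ (g : GL (Fin 2) (AlgebraicClosure K)) (f : (AlgebraicClosure K)[X]),
    ∀ x : OnePoint (AlgebraicClosure K),
      g • ratMap (AlgebraicClosure K) φ (g⁻¹ • x) =
        ratMap (AlgebraicClosure K)
          (algebraMap (AlgebraicClosure K)[X] (RatFunc (AlgebraicClosure K)) f) x

/-- The absolute Galois group `Gal(K̄/K)`. -/
abbrev Gal (K : Type*) [Field K] : Type _ := AlgebraicClosure K ≃ₐ[K] AlgebraicClosure K

/-- The absolute Galois group acts on the projective line over the algebraic closure. -/
def galMap {K : Type*} [Field K] (σ : Gal K) :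
    OnePoint (AlgebraicClosure K) → OnePoint (AlgebraicClosure K) :=
  OnePoint.map (fun x => σ x)

/-- `α ∈ K` as a point of the projective line over the algebraic closure. -/
def basePoint {K : Type*} [Field K] (α : K) : OnePoint (AlgebraicClosure K) :=
  ((algebraMap K (AlgebraicClosure K) α : AlgebraicClosure K) :
    OnePoint (AlgebraicClosure K))

/-- The `n`-th level `V_n = φ⁻ⁿ(α) ⊆ ℙ¹(K̄)` of the preimage tree. -/
def level {K : Type*} [Field K] (φ : RatFunc K) (α : K) (n : ℕ) :
    Set (OnePoint (AlgebraicClosure K)) :=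
  {β | (ratMap (AlgebraicClosure K) φ)^[n] β = basePoint α}

/-- The vertices of `T_α`: the root `α` (level `0`) and all its iterated preimages. -/
abbrev Vertex {K : Type*} [Field K] (φ : RatFunc K) (α : K) : Type _ :=
  {β : OnePoint (AlgebraicClosure K) // β ∈ ⋃ n, level φ α n}

/-- The root of `T_α`. -/
def root {K : Type*} [Field K] (φ : RatFunc K) (α : K) : Vertex φ α :=
  ⟨basePoint α, Set.mem_iUnion.2 ⟨0, rfl⟩⟩

/-- The graph `T_α` of iterated preimages of `α`: there is an edge between `β` and `φ(β)`. (It is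
a tree when `α` is not periodic under `φ`, so that the levels are disjoint.) -/
def preimageTree {K : Type*} [Field K] (φ : RatFunc K) (α : K) : SimpleGraph (Vertex φ α) :=
  SimpleGraph.fromRel fun β γ => ratMap (AlgebraicClosure K) φ β.1 = γ.1

/-- `Aut(T_α)`: the automorphisms of the rooted tree `T_α`, that is, the graph automorphisms
that fix the root. -/
def treeAut {K : Type*} [Field K] (φ : RatFunc K) (α : K) :
    Subgroup (preimageTree φ α ≃g preimageTree φ α) where
  carrier := {e | e (root φ α) = root φ α}
  one_mem' := rfl
  mul_mem' := fun {a b} (ha : a _ = _) (hb : b _ = _) => by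
    change a (b _) = _
    rw [hb, ha]
  inv_mem' := fun {a} (ha : a _ = _) => by
    change a.symm _ = _
    exact a.symm_apply_eq.2 ha.symm

section Galois

variable {K : Type*} [Field K]

theorem galMap_one (x : OnePoint (AlgebraicClosure K)) :
    galMap (1 : Gal K) x = x := by
  cases x <;> rfl

theorem galMap_mul (σ τ : Gal K) (x : OnePoint (AlgebraicClosure K)) :
    galMap (σ * τ) x = galMap σ (galMap τ x) := by
  cases x <;> rfl

theorem galMap_basePoint (σ : Gal K) (α : K) :
    galMap σ (basePoint α) = basePoint α :=
  congrArg (OnePoint.some : AlgebraicClosure K → OnePoint (AlgebraicClosure K))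
    (AlgEquiv.commutes σ α)

/-- The action of the Galois group commutes with `φ`. -/
theorem ratMap_galMap (φ : RatFunc K) (σ : Gal K)
    (x : OnePoint (AlgebraicClosure K)) :
    ratMap (AlgebraicClosure K) φ (galMap σ x) =
      galMap σ (ratMap (AlgebraicClosure K) φ x) := by
  cases x with
  | infty =>
    change ratMap (AlgebraicClosure K) φ ∞ = galMap σ (ratMap (AlgebraicClosure K) φ ∞)
    simp only [ratMap]
    split_ifs
    · rfl
    · exact (galMap_basePoint σ _).symm
  | coe x =>
    have h (p : K[X]) : aeval (σ x) p = σ (aeval x p) :=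
      Polynomial.aeval_algHom_apply (σ : AlgebraicClosure K →ₐ[K] AlgebraicClosure K) x p
    change ratMap (AlgebraicClosure K) φ ((σ x : AlgebraicClosure K) : OnePoint _) = _
    by_cases h0 : aeval x φ.denom = 0
    · have h1 : aeval (σ x) φ.denom = 0 := by rw [h, h0, map_zero]
      simp only [ratMap, if_pos h0, if_pos h1]
      rfl
    · have h1 : aeval (σ x) φ.denom ≠ 0 := fun h' => h0 (by simpa [h] using h')
      simp only [ratMap, if_neg h0, if_neg h1]
      rw [h, h, ← map_div₀]
      rfl

theorem galMap_mem (φ : RatFunc K) (α : K) (σ : Gal K)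
    {x : OnePoint (AlgebraicClosure K)} (hx : x ∈ ⋃ n, level φ α n) :
    galMap σ x ∈ ⋃ n, level φ α n := by
  obtain ⟨n, hn⟩ := Set.mem_iUnion.1 hx
  refine Set.mem_iUnion.2 ⟨n, ?_⟩
  have hc : Function.Commute (ratMap (AlgebraicClosure K) φ) (galMap σ) := ratMap_galMap φ σ
  change _ = _ at hn
  change _ = _
  rw [(hc.iterate_left n) x, hn, galMap_basePoint]

theorem galMap_inv_left (σ : Gal K) (x : OnePoint (AlgebraicClosure K)) :
    galMap σ⁻¹ (galMap σ x) = x := by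
  rw [← galMap_mul, inv_mul_cancel, galMap_one]

theorem galMap_inv_right (σ : Gal K) (x : OnePoint (AlgebraicClosure K)) :
    galMap σ (galMap σ⁻¹ x) = x := by
  rw [← galMap_mul, mul_inv_cancel, galMap_one]

/-- The permutation of the vertices of `T_α` induced by a Galois automorphism. -/
def galVertex (φ : RatFunc K) (α : K) (σ : Gal K) :
    Vertex φ α ≃ Vertex φ α where
  toFun x := ⟨galMap σ x.1, galMap_mem φ α σ x.2⟩
  invFun x := ⟨galMap σ⁻¹ x.1, galMap_mem φ α σ⁻¹ x.2⟩
  left_inv x := Subtype.ext (galMap_inv_left σ x.1)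
  right_inv x := Subtype.ext (galMap_inv_right σ x.1)

theorem galVertex_rel (φ : RatFunc K) (α : K) (σ : Gal K)
    (x y : Vertex φ α) :
    ratMap (AlgebraicClosure K) φ (galVertex φ α σ x).1 = (galVertex φ α σ y).1 ↔
      ratMap (AlgebraicClosure K) φ x.1 = y.1 := by
  change ratMap (AlgebraicClosure K) φ (galMap σ x.1) = galMap σ y.1 ↔ _
  rw [ratMap_galMap]
  exact (Function.LeftInverse.injective (galMap_inv_left σ)).eq_iff

/-- The automorphism of `T_α` induced by a Galois automorphism. -/
def galIso (φ : RatFunc K) (α : K) (σ : Gal K) :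
    preimageTree φ α ≃g preimageTree φ α where
  toEquiv := galVertex φ α σ
  map_rel_iff' := by
    intro x y
    simp only [preimageTree, SimpleGraph.fromRel_adj, galVertex_rel, ne_eq,
      EmbeddingLike.apply_eq_iff_eq]

/-- The arboreal Galois representation `ρ : Gal(K̄/K) → Aut(T_α)` attached to `(φ, α)`. -/
def arborealRep (φ : RatFunc K) (α : K) : Gal K →* treeAut φ α where
  toFun σ := ⟨galIso φ α σ, Subtype.ext (galMap_basePoint σ α)⟩
  map_one' := Subtype.ext (RelIso.ext fun x => Subtype.ext (galMap_one x.1))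
  map_mul' σ τ := Subtype.ext (RelIso.ext fun x => Subtype.ext (galMap_mul σ τ x.1))

/-- `G_∞`: the image of the arboreal representation in `Aut(T_α)`. -/
def arborealImage (φ : RatFunc K) (α : K) : Subgroup (treeAut φ α) :=
  (arborealRep φ α).range

end Galois

end Arboreal

end

/-!
Over `β` the map `φ` has the preimages `(-2β ± √δ(β)) / (3 + β)`, where `δ(β) = (5β - 3)(β + 1)`
vanishes exactly at the branch points `3/5` and `-1`. The root is the only rational vertex, since
`1 + 3q² = 0` has no rational solution; so no vertex is at infinity or a branch point, the root is
not periodic, and the preimage tree is a complete binary tree.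

Surjectivity says that on each level `V_n` every system of signs of the `√δ(β)`, `β ∈ V_n`, is
realized by an automorphism that fixes `V_n` pointwise (`exists_signChar_eq`); the absolute Galois
group being compact, this suffices (`IsTreeMap.exists_algEquiv_eq`). If some system of signs is
not realized, a nontrivial product of discriminants `δ(β)` is a square in `ℚ(V_n)`. The set of
such relations, a space of functions `V_n → ℤ/2`, is stable under the Galois group. Starting from
a nonzero relation, and using the sign changes already known on the lower levels,
`exists_isRelation_descend` produces nonzero relations pulled back from levels closer and closer
to the root. The last one is constant, so the product of all `δ(β)` is a square in `ℚ(V_n)`.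

That is impossible because of ramification (`prod_sqrtDisc_notMem_adjoin`). The critical value `-1`
lies in the cycle `1 ↔ -1`, so up to rational squares the product of the `δ(β)` is, for some sign,
`± a_n`, with `a_n` the numerator of `φⁿ(3/5)` (`prod_disc`). As `0 ↦ 1 ↦ -1 ↦ 1`, the root is not
periodic modulo any odd prime and the `a_n` are coprime away from `2`; modulo `5` they are
non-squares. So some prime `p` other than `2` and `5` divides `a_n` with odd multiplicity and
divides no earlier `a_m`. On the lower levels the discriminants then have even `p`-adic valuation,
and an elementary argument with values (`map_add_mul_mem_padicValues`) shows that an extension of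
the `p`-adic absolute value takes on `ℚ(V_n)` only values in `p ^ ℤ` and `0`, which excludes
`√(± a_n)`.

Finally, a nonconstant polynomial map has a fixed point that is its own only preimage, and such a
point would be a fixed branch point of `φ` (`not_isConjToPolynomial`).
-/

namespace QuadraticTree

/-! ### The homogeneous lift of the map -/

/-- The lift `(x, y) ↦ (y² + 3x², y² - 4xy - x²)` of `φ` to homogeneous coordinates. -/
def lift {R : Type*} [CommRing R] (w : R × R) : R × R :=
  (w.2 ^ 2 + 3 * w.1 ^ 2, w.2 ^ 2 - 4 * w.1 * w.2 - w.1 ^ 2)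

section Ring

variable {R S : Type*} [CommRing R] [CommRing S]

theorem iterate_lift_map (f : R →+* S) (n : ℕ) (w : R × R) :
    lift^[n] (Prod.map f f w) = Prod.map f f (lift^[n] w) := by
  have h : Function.Semiconj (Prod.map f f) (lift (R := R)) (lift (R := S)) := by
    intro w
    have h3 : f 3 = 3 := map_ofNat f 3
    have h4 : f 4 = 4 := map_ofNat f 4
    simp [lift, h3, h4]
  exact ((h.iterate_right n) w).symm

/-- `lift` is homogeneous of degree two, so its iterates preserve proportionality. -/
theorem exists_iterate_lift_smul (c : R) (n : ℕ) (w : R × R) :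
    ∃ d : R, lift^[n] (c • w) = d • lift^[n] w := by
  induction n generalizing c w with
  | zero => exact ⟨c, rfl⟩
  | succ n ih =>
    have h : lift (c • w) = c ^ 2 • lift w := by
      ext <;> simp [lift] <;> ring
    simp only [Function.iterate_succ_apply, h]
    exact ih _ _

end Ring

section Field

variable {k : Type*} [Field k]

theorem lift_ne_zero (h2 : (2 : k) ≠ 0) {w : k × k} (hw : w ≠ 0) : lift w ≠ 0 := by
  intro h
  apply hw
  have h1 : w.2 ^ 2 + 3 * w.1 ^ 2 = 0 := congrArg Prod.fst h
  have h3 : w.2 ^ 2 - 4 * w.1 * w.2 - w.1 ^ 2 = 0 := congrArg Prod.snd h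
  have h4 : 2 * (2 * (w.1 * (w.1 + w.2))) = 0 := by linear_combination h1 - h3
  have h5 : w.1 = 0 ∨ w.1 + w.2 = 0 := by simpa [h2] using h4
  have h6 : w.1 = 0 := by
    rcases h5 with h | h
    · exact h
    · have : 2 * (2 * w.1 ^ 2) = 0 := by linear_combination h1 + (w.1 - w.2) * h
      simpa [h2] using this
  have h7 : w.2 = 0 := by simpa [h6] using h1
  exact Prod.ext h6 h7

theorem iterate_lift_ne_zero (h2 : (2 : k) ≠ 0) {w : k × k} (hw : w ≠ 0) (n : ℕ) :
    lift^[n] w ≠ 0 := by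
  induction n generalizing w with
  | zero => exact hw
  | succ n ih => exact ih (lift_ne_zero h2 hw)

/-- The points `1` and `-1` form a cycle of `φ`, which avoids `0`. -/
theorem fst_iterate_lift_ne_zero_of_sq_eq (h2 : (2 : k) ≠ 0) {w : k × k} (hw : w.1 ≠ 0)
    (h : w.2 ^ 2 = w.1 ^ 2) (n : ℕ) : (lift^[n] w).1 ≠ 0 := by
  induction n generalizing w with
  | zero => exact hw
  | succ n ih =>
    have h1 : (lift w).1 = 2 * (2 * w.1 ^ 2) := by
      simp only [lift]; linear_combination h
    refine ih (w := lift w) (by rw [h1]; simp [h2, hw]) ?_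
    simp only [lift]
    linear_combination -8 * w.1 * (w.2 - w.1) * h

/-- The point `0` is not periodic: it is mapped to `1`, and then to `-1` and back. -/
theorem fst_iterate_lift_ne_zero_of_lt (h2 : (2 : k) ≠ 0) {w : k × k} (hw : w ≠ 0) {m n : ℕ}
    (hmn : m < n) (h : (lift^[m] w).1 = 0) : (lift^[n] w).1 ≠ 0 := by
  obtain ⟨j, rfl⟩ := Nat.exists_eq_add_of_lt hmn
  rw [show m + j + 1 = j + (m + 1) by ring, Function.iterate_add_apply,
    Function.iterate_succ_apply']
  have hy : (lift^[m] w).2 ≠ 0 := fun h' => iterate_lift_ne_zero h2 hw m (Prod.ext h h')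
  refine fst_iterate_lift_ne_zero_of_sq_eq h2 ?_ ?_ j
  · simpa [lift, h] using hy
  · simp [lift, h]

end Field

/-! ### The critical orbit of `3/5` -/

theorem fst_lift_pos {R : Type*} [CommRing R] [LinearOrder R] [IsStrictOrderedRing R]
    {w : R × R} (hw : w ≠ 0) : 0 < (lift w).1 := by
  simp only [lift]
  by_cases h1 : w.1 = 0
  · have h2 : w.2 ≠ 0 := fun h2 => hw (Prod.ext h1 h2)
    positivity
  · positivity

theorem fst_iterate_lift_pos {R : Type*} [CommRing R] [LinearOrder R] [IsStrictOrderedRing R]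
    {w : R × R} (hw : 0 < w.1) (n : ℕ) : 0 < (lift^[n] w).1 := by
  induction n generalizing w with
  | zero => exact hw
  | succ n ih => exact ih (fst_lift_pos fun h => hw.ne' (congrArg Prod.fst h))

/-- The integer `a_n`, the numerator of `φⁿ(3/5)` up to a power of `4`. -/
def critNum (n : ℕ) : ℤ := (lift^[n] ((3, 5) : ℤ × ℤ)).1

theorem critNum_pos (n : ℕ) : 0 < critNum n := fst_iterate_lift_pos (by norm_num) n

theorem cast_critNum {R : Type*} [CommRing R] (n : ℕ) :
    (critNum n : R) = (lift^[n] ((3, 5) : R × R)).1 := by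
  have h := iterate_lift_map (Int.castRingHom R) n (3, 5)
  rw [show Prod.map (Int.castRingHom R) (Int.castRingHom R) (3, 5) = ((3, 5) : R × R) by
    simp] at h
  rw [h]
  rfl

/-- The `2`-adic valuations along the orbit are even. -/
theorem exists_iterate_lift_eq_four_pow (n : ℕ) : ∃ (e : ℕ) (u v : ℤ), Odd u ∧ Odd v ∧
    lift^[n] ((3, 5) : ℤ × ℤ) = (4 ^ e * u, 4 ^ e * v) := by
  induction n with
  | zero => exact ⟨0, 3, 5, by decide, by decide, rfl⟩
  | succ n ih =>
    obtain ⟨e, _, _, ⟨a, rfl⟩, ⟨b, rfl⟩, h⟩ := ih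
    obtain ⟨i, hi⟩ := (Int.even_mul_succ_self a).two_dvd
    obtain ⟨j, hj⟩ := (Int.even_mul_succ_self b).two_dvd
    rw [Function.iterate_succ_apply', h]
    refine ⟨2 * e + 1, 2 * j + 6 * i + 1, 2 * j - 2 * i - (2 * a + 1) * (2 * b + 1),
      ⟨j + 3 * i, by ring⟩, ⟨j - i - 2 * a * b - a - b - 1, by ring⟩, ?_⟩
    simp only [lift]
    ext
    · linear_combination 4 * (4 ^ e) ^ 2 * hj + 12 * (4 ^ e) ^ 2 * hi
    · linear_combination 4 * (4 ^ e) ^ 2 * hj - 4 * (4 ^ e) ^ 2 * hi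

/-- Modulo `5` the orbit is constant, up to scaling by squares, from the first iterate on, and
`a_n` is always a non-square. -/
theorem not_isSquare_critNum_mod_five (n : ℕ) : ¬ IsSquare (critNum n : ZMod 5) := by
  have key : ∀ m, lift^[m] ((3, 5) : ZMod 5 × ZMod 5) ∈
      ({(3, 0), (2, 1), (3, 4)} : Finset (ZMod 5 × ZMod 5)) := by
    intro m
    induction m with
    | zero => decide
    | succ m ih =>
      rw [Function.iterate_succ_apply']
      generalize lift^[m] ((3, 5) : ZMod 5 × ZMod 5) = w at ih
      revert w
      decide
  rw [cast_critNum]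
  have h := key n
  generalize lift^[n] ((3, 5) : ZMod 5 × ZMod 5) = w at h
  revert w
  decide

/-- A natural number that is not a square has a prime factor of odd multiplicity. -/
theorem exists_prime_odd_factorization {u : ℕ} (hu : u ≠ 0) (h : ¬ IsSquare u) :
    ∃ p, p.Prime ∧ Odd (u.factorization p) := by
  obtain ⟨a, b, hab, ha⟩ := Nat.sq_mul_squarefree u
  have ha1 : a ≠ 1 := by
    rintro rfl
    exact h ⟨b, by rw [← hab]; ring⟩
  obtain ⟨p, hp, hpa⟩ := Nat.exists_prime_and_dvd ha1
  have hb0 : b ≠ 0 := by rintro rfl; simp at hab; exact hu hab.symm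
  have ha0 : a ≠ 0 := ha.ne_zero
  refine ⟨p, hp, ?_⟩
  have h1 : a.factorization p = 1 :=
    le_antisymm (ha.natFactorization_le_one p)
      ((hp.dvd_iff_one_le_factorization ha0).1 hpa)
  rw [← hab, Nat.factorization_mul (pow_ne_zero 2 hb0) ha0, Nat.factorization_pow]
  simp [h1, parity_simps]

/-- Every `a_n` has an odd prime factor of odd multiplicity. -/
theorem exists_prime_odd_padicValInt_critNum (n : ℕ) :
    ∃ p, p.Prime ∧ p ≠ 2 ∧ Odd (padicValInt p (critNum n)) := by
  obtain ⟨e, u, v, hu, -, h⟩ := exists_iterate_lift_eq_four_pow n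
  have hc : critNum n = 4 ^ e * u := congrArg Prod.fst h
  have hpos : 0 < u := by
    have := critNum_pos n
    rw [hc] at this
    exact pos_of_mul_pos_right this (by positivity)
  lift u to ℕ using hpos.le
  have hns : ¬ IsSquare u := by
    rintro ⟨c, rfl⟩
    apply not_isSquare_critNum_mod_five n
    refine ⟨2 ^ e * c, ?_⟩
    rw [hc, show (4 : ℤ) = 2 * 2 by norm_num, mul_pow]
    push_cast
    ring
  have hu0 : u ≠ 0 := by rintro rfl; simp at hpos
  obtain ⟨p, hp, hodd⟩ := exists_prime_odd_factorization hu0 hns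
  have hp2 : p ≠ 2 := by
    rintro rfl
    have : ¬ 2 ∣ u := by
      rw [← even_iff_two_dvd, Nat.not_even_iff_odd]
      exact_mod_cast hu
    rw [Nat.factorization_eq_zero_of_not_dvd this] at hodd
    simp at hodd
  refine ⟨p, hp, hp2, ?_⟩
  have hp4 : ¬ p ∣ 4 ^ e := fun hd => hp2 <| (Nat.prime_dvd_prime_iff_eq hp Nat.prime_two).1 <|
    hp.dvd_of_dvd_pow (show p ∣ 2 ^ 2 from hp.dvd_of_dvd_pow hd)
  have hv : padicValInt p (critNum n) = u.factorization p := by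
    rw [hc, padicValInt, Int.natAbs_mul, Int.natAbs_pow, Int.natAbs_natCast,
      ← Nat.factorization_def _ hp, Nat.factorization_mul (by simp) hu0,
      Finsupp.add_apply]
    change (4 ^ e).factorization p + _ = _
    rw [Nat.factorization_eq_zero_of_not_dvd hp4, zero_add]
  rwa [hv]

/-- The numbers `a_n` are coprime away from `2`. -/
theorem not_dvd_critNum_of_lt {p : ℕ} (hp : p.Prime) (hp2 : p ≠ 2) {m n : ℕ} (hmn : m < n)
    (hn : (p : ℤ) ∣ critNum n) : ¬ (p : ℤ) ∣ critNum m := by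
  intro hm
  have := Fact.mk hp
  rw [← ZMod.intCast_zmod_eq_zero_iff_dvd, cast_critNum] at hm hn
  have h2 : (2 : ZMod p) ≠ 0 := Ring.two_ne_zero (by rwa [ZMod.ringChar_zmod_n])
  refine fst_iterate_lift_ne_zero_of_lt h2 (fun h => ?_) hmn hm hn
  have h3 : (3 : ZMod p) = 0 := congrArg Prod.fst h
  have h5 : (5 : ZMod p) = 0 := congrArg Prod.snd h
  exact h2 (by linear_combination h5 - h3)

theorem not_dvd_fst_iterate_lift_neg_one {p : ℕ} (hp : p.Prime) (hp2 : p ≠ 2) (n : ℕ) :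
    ¬ (p : ℤ) ∣ (lift^[n] ((-1, 1) : ℤ × ℤ)).1 := by
  intro h
  have := Fact.mk hp
  have h2 : (2 : ZMod p) ≠ 0 := Ring.two_ne_zero (by rwa [ZMod.ringChar_zmod_n])
  rw [← ZMod.intCast_zmod_eq_zero_iff_dvd] at h
  have h' := iterate_lift_map (Int.castRingHom (ZMod p)) n (-1, 1)
  refine fst_iterate_lift_ne_zero_of_sq_eq (k := ZMod p) h2 (w := (-1, 1)) (by simp) (by simp) n ?_
  simp only [Prod.map_apply, map_neg, map_one] at h'
  rw [h']
  exact h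

/-! ### The levels of the tree inside the algebraic closure -/

/-- The algebraic closure of `ℚ`. -/
abbrev Qbar : Type := AlgebraicClosure ℚ

/-- The canonical `ℚ`-algebra structure of the algebraic closure, the one for which Mathlib knows
that `ℚ̄` is algebraic over `ℚ`. Instance search prefers `DivisionRing.toRatAlgebra`, which is
equal to it but not reducibly so. -/
noncomputable abbrev qbarAlgebra : Algebra ℚ Qbar := AlgebraicClosure.instAlgebra ℚ

attribute [local instance] qbarAlgebra

/-- The map `φ` on the affine line, with value `0` at its poles. -/
noncomputable def phi (x : Qbar) : Qbar := (1 + 3 * x ^ 2) / (1 - 4 * x - x ^ 2)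

/-- A quarter of the discriminant of `(3 + β) x² + 4βx + (1 - β)`, whose roots are the
preimages of `β` under `φ`. -/
noncomputable def disc (β : Qbar) : Qbar := (5 * β - 3) * (β + 1)

/-- A chosen square root of `disc β`. -/
noncomputable def sqrtDisc (β : Qbar) : Qbar :=
  (IsAlgClosed.exists_pow_nat_eq (disc β) two_pos).choose

theorem sqrtDisc_sq (β : Qbar) : sqrtDisc β ^ 2 = disc β :=
  (IsAlgClosed.exists_pow_nat_eq (disc β) two_pos).choose_spec

/-- The preimage of `β` attached to the root `sqrtDisc β`. -/
noncomputable def childPos (β : Qbar) : Qbar := (-2 * β + sqrtDisc β) / (3 + β)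

/-- The preimage of `β` attached to the root `-sqrtDisc β`. -/
noncomputable def childNeg (β : Qbar) : Qbar := (-2 * β - sqrtDisc β) / (3 + β)

open Classical in
/-- The set `φ⁻ⁿ(0)`, as a finite subset of the affine line. -/
noncomputable def layer : ℕ → Finset Qbar
  | 0 => {0}
  | n + 1 => (layer n).biUnion fun β => {childPos β, childNeg β}

theorem layer_zero : layer 0 = {0} := rfl

theorem mem_layer_succ {n : ℕ} {x : Qbar} :
    x ∈ layer (n + 1) ↔ ∃ β ∈ layer n, x = childPos β ∨ x = childNeg β := by
  simp [layer]

theorem preimage_iff_eq_child {β x : Qbar} (hβ : 3 + β ≠ 0) :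
    (3 + β) * x ^ 2 + 4 * β * x + (1 - β) = 0 ↔ x = childPos β ∨ x = childNeg β := by
  have h := sqrtDisc_sq β
  rw [disc] at h
  have h1 : (3 + β) * ((3 + β) * x ^ 2 + 4 * β * x + (1 - β)) =
      ((3 + β) * x - (-2 * β + sqrtDisc β)) * ((3 + β) * x - (-2 * β - sqrtDisc β)) := by
    linear_combination h
  rw [childPos, childNeg, eq_div_iff hβ, eq_div_iff hβ, ← mul_eq_zero_iff_left hβ, h1,
    mul_eq_zero, sub_eq_zero, sub_eq_zero, mul_comm x]

theorem denom_ne_zero_of_preimage {β x : Qbar}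
    (h : (3 + β) * x ^ 2 + 4 * β * x + (1 - β) = 0) : 1 - 4 * x - x ^ 2 ≠ 0 := by
  intro h0
  have h1 : 1 + 3 * x ^ 2 = 0 := by linear_combination h + β * h0
  have h2 : 4 * (x * (x + 1)) = 0 := by linear_combination h1 - h0
  have h3 : x = 0 ∨ x + 1 = 0 := by simpa using h2
  rcases h3 with h3 | h3
  · rw [h3] at h1; norm_num at h1
  · rw [eq_neg_of_add_eq_zero_left h3] at h1; norm_num at h1

theorem preimage_iff_phi_eq {β x : Qbar} :
    (3 + β) * x ^ 2 + 4 * β * x + (1 - β) = 0 ↔ 1 - 4 * x - x ^ 2 ≠ 0 ∧ phi x = β := by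
  constructor
  · intro h
    have h0 := denom_ne_zero_of_preimage h
    refine ⟨h0, ?_⟩
    rw [phi, div_eq_iff h0]
    linear_combination h
  · rintro ⟨h0, h⟩
    rw [phi, div_eq_iff h0] at h
    linear_combination h

/-- The root is the only rational vertex, because `1 + 3q² = 0` has no rational solution. -/
theorem eq_zero_of_algebraMap_mem_layer {n : ℕ} {q : ℚ} (h : algebraMap ℚ Qbar q ∈ layer n) :
    n = 0 ∧ q = 0 := by
  induction n generalizing q with
  | zero =>
    rw [layer_zero, Finset.mem_singleton, map_eq_zero] at h
    exact ⟨rfl, h⟩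
  | succ n ih =>
    exfalso
    obtain ⟨β, hβ, hx⟩ := mem_layer_succ.1 h
    have h3 : 3 + β ≠ 0 := by
      intro h3
      have : β = algebraMap ℚ Qbar (-3) := by
        simp only [map_neg, map_ofNat]
        linear_combination h3
      rw [this] at hβ
      exact absurd (ih hβ).2 (by norm_num)
    obtain ⟨hd, hx⟩ := preimage_iff_phi_eq.1 ((preimage_iff_eq_child h3).2 hx)
    have hq : β = algebraMap ℚ Qbar ((1 + 3 * q ^ 2) / (1 - 4 * q - q ^ 2)) := by
      rw [← hx, phi]
      simp
    rcases div_eq_zero_iff.1 (ih (hq ▸ hβ)).2 with h0 | h0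
    · exact absurd h0 (by positivity)
    · exact hd (by simpa using congrArg (algebraMap ℚ Qbar) h0)

theorem algebraMap_ne_of_mem_layer {n : ℕ} {β : Qbar} (hβ : β ∈ layer n) {q : ℚ} (hq : q ≠ 0) :
    β ≠ algebraMap ℚ Qbar q := by
  rintro rfl
  exact hq (eq_zero_of_algebraMap_mem_layer hβ).2

theorem three_add_ne_zero {n : ℕ} {β : Qbar} (hβ : β ∈ layer n) : 3 + β ≠ 0 := by
  intro h
  apply algebraMap_ne_of_mem_layer hβ (q := -3) (by norm_num)
  simp only [map_neg, map_ofNat]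
  linear_combination h

theorem disc_ne_zero {n : ℕ} {β : Qbar} (hβ : β ∈ layer n) : disc β ≠ 0 := by
  refine mul_ne_zero (fun h => ?_) fun h => ?_
  · apply algebraMap_ne_of_mem_layer hβ (q := 3 / 5) (by norm_num)
    rw [map_div₀, map_ofNat, map_ofNat, eq_div_iff (by norm_num)]
    linear_combination h
  · apply algebraMap_ne_of_mem_layer hβ (q := -1) (by norm_num)
    rw [map_neg, map_one]
    linear_combination h

theorem sqrtDisc_ne_zero {n : ℕ} {β : Qbar} (hβ : β ∈ layer n) : sqrtDisc β ≠ 0 := by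
  intro h
  have := sqrtDisc_sq β
  rw [h] at this
  exact disc_ne_zero hβ (by simpa using this.symm)

theorem childPos_ne_childNeg {n : ℕ} {β : Qbar} (hβ : β ∈ layer n) : childPos β ≠ childNeg β := by
  intro h
  rw [childPos, childNeg, div_left_inj' (three_add_ne_zero hβ)] at h
  have h2 : 2 * sqrtDisc β = 0 := by linear_combination h
  exact sqrtDisc_ne_zero hβ (by simpa using h2)

theorem childPos_mem_layer {n : ℕ} {β : Qbar} (hβ : β ∈ layer n) : childPos β ∈ layer (n + 1) :=
  mem_layer_succ.2 ⟨β, hβ, Or.inl rfl⟩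

theorem childNeg_mem_layer {n : ℕ} {β : Qbar} (hβ : β ∈ layer n) : childNeg β ∈ layer (n + 1) :=
  mem_layer_succ.2 ⟨β, hβ, Or.inr rfl⟩

theorem phi_childPos {n : ℕ} {β : Qbar} (hβ : β ∈ layer n) : phi (childPos β) = β :=
  (preimage_iff_phi_eq.1 ((preimage_iff_eq_child (three_add_ne_zero hβ)).2 (Or.inl rfl))).2

theorem phi_childNeg {n : ℕ} {β : Qbar} (hβ : β ∈ layer n) : phi (childNeg β) = β :=
  (preimage_iff_phi_eq.1 ((preimage_iff_eq_child (three_add_ne_zero hβ)).2 (Or.inr rfl))).2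

theorem mem_layer_succ_iff_phi_mem {n : ℕ} {x : Qbar} :
    x ∈ layer (n + 1) ↔ 1 - 4 * x - x ^ 2 ≠ 0 ∧ phi x ∈ layer n := by
  rw [mem_layer_succ]
  constructor
  · rintro ⟨β, hβ, hx⟩
    obtain ⟨hd, rfl⟩ :=
      preimage_iff_phi_eq.1 ((preimage_iff_eq_child (three_add_ne_zero hβ)).2 hx)
    exact ⟨hd, hβ⟩
  · rintro ⟨hd, hx⟩
    exact ⟨phi x, hx, (preimage_iff_eq_child (three_add_ne_zero hx)).1
      (preimage_iff_phi_eq.2 ⟨hd, rfl⟩)⟩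

theorem phi_mem_layer {n : ℕ} {x : Qbar} (hx : x ∈ layer (n + 1)) : phi x ∈ layer n :=
  (mem_layer_succ_iff_phi_mem.1 hx).2

theorem eq_child_of_phi_eq {n : ℕ} {x β : Qbar} (hx : x ∈ layer (n + 1)) (h : phi x = β) :
    x = childPos β ∨ x = childNeg β := by
  obtain ⟨hd, hx⟩ := mem_layer_succ_iff_phi_mem.1 hx
  rw [h] at hx
  exact (preimage_iff_eq_child (three_add_ne_zero hx)).1 (preimage_iff_phi_eq.2 ⟨hd, h⟩)

theorem iterate_phi_mem_layer {k n : ℕ} {x : Qbar} (hx : x ∈ layer (n + k)) :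
    phi^[k] x ∈ layer n := by
  induction k generalizing x with
  | zero => exact hx
  | succ k ih => exact ih (phi_mem_layer hx)

/-- The levels are disjoint, because the root is not periodic. -/
theorem layer_unique {m n : ℕ} {x : Qbar} (hm : x ∈ layer m) (hn : x ∈ layer n) : m = n := by
  wlog hmn : m ≤ n generalizing m n
  · exact (this hn hm (le_of_not_ge hmn)).symm
  obtain ⟨k, rfl⟩ := Nat.exists_eq_add_of_le hmn
  have h0 : phi^[m] x ∈ layer 0 := iterate_phi_mem_layer (by rwa [zero_add])
  have hk : phi^[m] x ∈ layer k := iterate_phi_mem_layer (by rwa [add_comm])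
  rw [layer_zero, Finset.mem_singleton] at h0
  rw [h0, ← map_zero (algebraMap ℚ Qbar)] at hk
  rw [(eq_zero_of_algebraMap_mem_layer hk).1, add_zero]

/-! ### The Galois action on the levels -/

theorem map_phi (σ : Qbar ≃ₐ[ℚ] Qbar) (x : Qbar) : σ (phi x) = phi (σ x) := by
  simp [phi, map_ofNat]

theorem map_iterate_phi (σ : Qbar ≃ₐ[ℚ] Qbar) (k : ℕ) (x : Qbar) :
    σ (phi^[k] x) = phi^[k] (σ x) :=
  (Function.Commute.iterate_right (f := σ) (fun x => map_phi σ x) k) x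

theorem map_disc (σ : Qbar ≃ₐ[ℚ] Qbar) (x : Qbar) : σ (disc x) = disc (σ x) := by
  simp [disc, map_ofNat]

theorem map_mem_layer {n : ℕ} (σ : Qbar ≃ₐ[ℚ] Qbar) {x : Qbar} (hx : x ∈ layer n) :
    σ x ∈ layer n := by
  induction n generalizing x with
  | zero =>
    rw [layer_zero, Finset.mem_singleton] at hx ⊢
    rw [hx, map_zero]
  | succ n ih =>
    rw [mem_layer_succ_iff_phi_mem] at hx ⊢
    refine ⟨?_, map_phi σ x ▸ ih hx.2⟩
    have := (map_ne_zero σ).2 hx.1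
    simpa [map_ofNat] using this

theorem map_sqrtDisc (σ : Qbar ≃ₐ[ℚ] Qbar) (β : Qbar) :
    σ (sqrtDisc β) = sqrtDisc (σ β) ∨ σ (sqrtDisc β) = -sqrtDisc (σ β) := by
  rw [← sq_eq_sq_iff_eq_or_eq_neg, ← map_pow, sqrtDisc_sq, sqrtDisc_sq, map_disc]

theorem map_childPos (σ : Qbar ≃ₐ[ℚ] Qbar) {β : Qbar} (hβ : σ β = β)
    (h : σ (sqrtDisc β) = -sqrtDisc β) :
    σ (childPos β) = childNeg β ∧ σ (childNeg β) = childPos β := by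
  simp [childPos, childNeg, map_ofNat, hβ, h, sub_eq_add_neg]

theorem map_childPos_of_fixed (σ : Qbar ≃ₐ[ℚ] Qbar) {β : Qbar} (hβ : σ β = β)
    (h : σ (sqrtDisc β) = sqrtDisc β) :
    σ (childPos β) = childPos β ∧ σ (childNeg β) = childNeg β := by
  simp [childPos, childNeg, map_ofNat, hβ, h]

/-! ### Products over a level -/

theorem prod_layer_succ {M : Type*} [CommMonoid M] (n : ℕ) (g : Qbar → M) :
    ∏ x ∈ layer (n + 1), g x = ∏ β ∈ layer n, g (childPos β) * g (childNeg β) := by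
  classical
  rw [layer, Finset.prod_biUnion]
  · exact Finset.prod_congr rfl fun β hβ => Finset.prod_pair (childPos_ne_childNeg hβ)
  · intro β hβ γ hγ hne
    rw [Function.onFun, Finset.disjoint_left]
    intro x hx hx'
    have key {δ : Qbar} (hδ : δ ∈ layer n) (hx : x ∈ ({childPos δ, childNeg δ} : Finset Qbar)) :
        phi x = δ := by
      rcases Finset.mem_insert.1 hx with rfl | hx
      · exact phi_childPos hδ
      · rw [Finset.mem_singleton.1 hx, phi_childNeg hδ]
    exact hne ((key hβ hx).symm.trans (key hγ hx'))

/-- The linear forms on a level are evaluated along the orbit of `lift`: up to a constant that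
does not depend on `w`, the value at `w` of the binary form with zeros `φ⁻ⁿ(0)` is the first
coordinate of the `n`-th iterate of `lift` at `w`. -/
theorem prod_layer_linear (n : ℕ) (w : Qbar × Qbar) :
    (lift^[n] (1, 0)).1 * ∏ x ∈ layer n, (w.1 - w.2 * x) = (lift^[n] w).1 := by
  induction n generalizing w with
  | zero => simp [layer_zero]
  | succ n ih =>
    have hP : ∏ x ∈ layer (n + 1), (w.1 - w.2 * x) =
        ∏ β ∈ layer n, ((lift w).1 - (lift w).2 * β) / (3 + β) := by
      rw [prod_layer_succ]
      refine Finset.prod_congr rfl fun β hβ => ?_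
      have h3 := three_add_ne_zero hβ
      have h := sqrtDisc_sq β
      rw [disc] at h
      rw [childPos, childNeg, lift, eq_div_iff h3]
      field_simp
      linear_combination (-w.2 ^ 2) * h
    have hc : (lift ((1, 0) : Qbar × Qbar)) = (3, -1) := by simp [lift]
    rw [hP, Finset.prod_div_distrib, Function.iterate_succ_apply, Function.iterate_succ_apply,
      ← ih (lift w), ← ih (lift (1, 0)), hc]
    have h3 : ∏ β ∈ layer n, (3 + β) ≠ 0 :=
      Finset.prod_ne_zero_iff.2 fun β hβ => three_add_ne_zero hβ
    simp only [neg_one_mul, sub_neg_eq_add]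
    field_simp

/-- The product of the discriminants over the `n`-th level is `a_n` times a square times a
unit away from `2`. -/
theorem prod_disc (n : ℕ) :
    ∃ c : ℚ, c ≠ 0 ∧ ∏ β ∈ layer n, disc β =
      algebraMap ℚ Qbar (critNum n * (lift^[n] ((-1, 1) : ℤ × ℤ)).1 / c ^ 2) := by
  have hpos : 0 < (lift^[n] ((1, 0) : ℚ × ℚ)).1 := fst_iterate_lift_pos (by norm_num) n
  refine ⟨(lift^[n] ((1, 0) : ℚ × ℚ)).1, hpos.ne', ?_⟩
  have hc : algebraMap ℚ Qbar (lift^[n] ((1, 0) : ℚ × ℚ)).1 = (lift^[n] (1, 0)).1 := by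
    have := iterate_lift_map (algebraMap ℚ Qbar) n (1, 0)
    rw [Prod.map_apply, map_one, map_zero] at this
    rw [this, Prod.map_fst]
  have hm : (((lift^[n] ((-1, 1) : ℤ × ℤ)).1 : ℤ) : Qbar) = (lift^[n] (-1, 1)).1 := by
    have := iterate_lift_map (Int.castRingHom Qbar) n (-1, 1)
    rw [Prod.map_apply, map_neg, map_one] at this
    rw [this]
    rfl
  rw [map_div₀, map_mul, map_pow, hc, map_intCast, map_intCast, hm, cast_critNum,
    ← prod_layer_linear n (3, 5), ← prod_layer_linear n (-1, 1)]
  have h0 : (lift^[n] ((1, 0) : Qbar × Qbar)).1 ≠ 0 := by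
    rw [← hc]
    exact (map_ne_zero _).2 hpos.ne'
  rw [eq_div_iff (pow_ne_zero 2 h0)]
  have : ∏ β ∈ layer n, disc β =
      (∏ x ∈ layer n, ((3 : Qbar) - 5 * x)) * ∏ x ∈ layer n, ((-1 : Qbar) - 1 * x) := by
    rw [← Finset.prod_mul_distrib]
    exact Finset.prod_congr rfl fun β _ => by rw [disc]; ring
  rw [this]
  ring

/-! ### Value groups of quadratic extensions -/

/-- An absolute value of `ℚ̄` that extends the `p`-adic one. -/
structure ExtendsPadic (p : ℕ) (v : AbsoluteValue Qbar ℝ) : Prop where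
  nonarch : IsNonarchimedean v
  map_rat : ∀ q : ℚ, v (algebraMap ℚ Qbar q) = (padicNorm p q : ℝ)

theorem exists_extendsPadic (p : ℕ) [Fact p.Prime] :
    ∃ v : AbsoluteValue Qbar ℝ, ExtendsPadic p v := by
  let ι : Qbar →ₐ[ℚ] PadicAlgCl p := IsAlgClosed.lift
  refine ⟨(IsAbsoluteValue.toAbsoluteValue (norm : PadicAlgCl p → ℝ)).comp ι.toRingHom.injective,
    ⟨fun x y => ?_, fun q => ?_⟩⟩
  · change ‖ι (x + y)‖ ≤ max ‖ι x‖ ‖ι y‖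
    rw [map_add]
    exact PadicAlgCl.isNonarchimedean p _ _
  · change ‖ι (algebraMap ℚ Qbar q)‖ = _
    rw [AlgHom.commutes, ← Padic.eq_padicNorm, ← PadicAlgCl.norm_extends]
    congr 1

/-- The values of the `p`-adic absolute value on `ℚ`. -/
def padicValues (p : ℕ) : Set ℝ := {r | r = 0 ∨ ∃ k : ℤ, r = (p : ℝ) ^ k}

section Values

variable {p : ℕ} {v : AbsoluteValue Qbar ℝ}

theorem one_mem_padicValues : (1 : ℝ) ∈ padicValues p := Or.inr ⟨0, by simp⟩

theorem padicNorm_mem_padicValues (q : ℚ) : (padicNorm p q : ℝ) ∈ padicValues p := by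
  by_cases hq : q = 0
  · left; simp [hq]
  · obtain ⟨z, hz⟩ := padicNorm.values_discrete (p := p) hq
    exact Or.inr ⟨-z, by rw [hz]; push_cast; rfl⟩

theorem ExtendsPadic.map_int (hv : ExtendsPadic p v) (m : ℤ) :
    v (m : Qbar) = (padicNorm p m : ℝ) := by
  rw [← hv.map_rat, map_intCast (algebraMap ℚ Qbar)]

variable [hp : Fact p.Prime]

theorem padicValues_div {r s : ℝ} (hr : r ∈ padicValues p) (hs : s ∈ padicValues p) :
    r / s ∈ padicValues p := by
  have h0 : (p : ℝ) ≠ 0 := Nat.cast_ne_zero.2 hp.out.ne_zero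
  rcases hr with rfl | ⟨k, rfl⟩
  · exact Or.inl (zero_div _)
  · rcases hs with rfl | ⟨l, rfl⟩
    · exact Or.inl (div_zero _)
    · exact Or.inr ⟨k - l, (zpow_sub₀ h0 k l).symm⟩

theorem padicValues_mul {r s : ℝ} (hr : r ∈ padicValues p) (hs : s ∈ padicValues p) :
    r * s ∈ padicValues p := by
  have h0 : (p : ℝ) ≠ 0 := Nat.cast_ne_zero.2 hp.out.ne_zero
  rcases hr with rfl | ⟨k, rfl⟩
  · exact Or.inl (zero_mul _)
  · rcases hs with rfl | ⟨l, rfl⟩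
    · exact Or.inl (mul_zero _)
    · exact Or.inr ⟨k + l, (zpow_add₀ h0 k l).symm⟩

theorem ExtendsPadic.map_int_eq_one (hv : ExtendsPadic p v) {m : ℤ} (h : ¬ (p : ℤ) ∣ m) :
    v (m : Qbar) = 1 := by
  rw [hv.map_int, (padicNorm.int_eq_one_iff m).2 h, Rat.cast_one]

theorem ExtendsPadic.map_int_le_one (hv : ExtendsPadic p v) (m : ℤ) : v (m : Qbar) ≤ 1 := by
  rw [hv.map_int]
  exact_mod_cast padicNorm.of_int m

theorem ExtendsPadic.dvd_of_map_int_lt_one (hv : ExtendsPadic p v) {m : ℤ}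
    (h : v (m : Qbar) < 1) : (p : ℤ) ∣ m := by
  by_contra hd
  exact h.ne (hv.map_int_eq_one hd)

/-- If `s²` lies in a field with values in `p ^ ℤ`, and so does the value of `s`, the elements
`a + bs` have their values there too: when the two terms do not cancel this is the
ultrametric equality, and otherwise `a - bs` has the value of `a`, and the norm
`a² - b²s²` lies in the field. -/
theorem map_add_mul_mem_padicValues (hv : ExtendsPadic p v) (hp2 : p ≠ 2)
    {F : IntermediateField ℚ Qbar} (hF : ∀ x ∈ F, v x ∈ padicValues p) {s : Qbar}
    (hs : s ^ 2 ∈ F) (hvs : v s ∈ padicValues p) {a b : Qbar} (ha : a ∈ F) (hb : b ∈ F) :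
    v (a + b * s) ∈ padicValues p := by
  have hvb : v (b * s) ∈ padicValues p := by
    rw [map_mul]
    exact padicValues_mul (hF b hb) hvs
  by_cases hne : v a = v (b * s)
  · have h2 : v (2 * a) = v a := by
      have h2 : v ((2 : ℤ) : Qbar) = 1 := hv.map_int_eq_one fun h =>
        hp2 ((Nat.prime_dvd_prime_iff_eq hp.out Nat.prime_two).1 (by exact_mod_cast h))
      rw [map_mul, show (2 : Qbar) = ((2 : ℤ) : Qbar) by norm_num, h2, one_mul]
    have hA : v (a + b * s) ≤ v a := (hv.nonarch _ _).trans (by rw [← hne, max_self])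
    have hB : v (a - b * s) ≤ v a := by
      rw [sub_eq_add_neg]
      exact (hv.nonarch _ _).trans (by rw [v.map_neg, ← hne, max_self])
    have hmax : v a ≤ max (v (a + b * s)) (v (a - b * s)) := by
      rw [← h2, show 2 * a = (a + b * s) + (a - b * s) by ring]
      exact hv.nonarch _ _
    rcases le_max_iff.1 hmax with h | h
    · rw [le_antisymm hA h]
      exact hF a ha
    · have hBa := le_antisymm hB h
      by_cases ha0 : v a = 0
      · left
        exact le_antisymm (hA.trans_eq ha0) (v.nonneg _)
      · have hprod : v (a + b * s) = v (a ^ 2 - b ^ 2 * s ^ 2) / v a := by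
          rw [eq_div_iff ha0, ← hBa, ← map_mul]
          congr 1
          ring
        rw [hprod]
        exact padicValues_div (hF _ (sub_mem (pow_mem ha 2) (mul_mem (pow_mem hb 2) hs))) (hF a ha)
  · rw [hv.nonarch.add_eq_max_of_ne hne]
    rcases max_choice (v a) (v (b * s)) with h | h <;> rw [h]
    exacts [hF a ha, hvb]

theorem exists_field_with_sqrt (hv : ExtendsPadic p v) (hp2 : p ≠ 2)
    {F : IntermediateField ℚ Qbar} (hF : ∀ x ∈ F, v x ∈ padicValues p) {s : Qbar}
    (hs : s ^ 2 ∈ F) (hvs : v s ∈ padicValues p) :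
    ∃ E : IntermediateField ℚ Qbar, F ≤ E ∧ s ∈ E ∧ ∀ x ∈ E, v x ∈ padicValues p := by
  open scoped IntermediateField in
  refine ⟨(F⟮s⟯).restrictScalars ℚ, fun x hx => ?_, ?_, fun x hx => ?_⟩
  · exact F⟮s⟯.algebraMap_mem ⟨x, hx⟩
  · exact IntermediateField.mem_adjoin_simple_self F s
  · have halg : IsAlgebraic F s := Algebra.IsAlgebraic.isAlgebraic s
    have hx' : x ∈ Algebra.adjoin F {s} := by
      rw [← IntermediateField.adjoin_simple_toSubalgebra_of_isAlgebraic halg]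
      exact hx
    have key : ∀ y ∈ Algebra.adjoin F {s}, ∃ a ∈ F, ∃ b ∈ F, y = a + b * s := by
      intro y hy
      induction hy using Algebra.adjoin_induction with
      | mem y hy =>
        rw [Set.mem_singleton_iff.1 hy]
        exact ⟨0, zero_mem F, 1, one_mem F, by ring⟩
      | algebraMap c => exact ⟨c, c.2, 0, zero_mem F, by rw [zero_mul, add_zero]; rfl⟩
      | add y z _ _ ihy ihz =>
        obtain ⟨a, ha, b, hb, rfl⟩ := ihy
        obtain ⟨c, hc, d, hd, rfl⟩ := ihz
        exact ⟨a + c, add_mem ha hc, b + d, add_mem hb hd, by ring⟩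
      | mul y z _ _ ihy ihz =>
        obtain ⟨a, ha, b, hb, rfl⟩ := ihy
        obtain ⟨c, hc, d, hd, rfl⟩ := ihz
        exact ⟨a * c + b * d * s ^ 2, add_mem (mul_mem ha hc) (mul_mem (mul_mem hb hd) hs),
          a * d + b * c, add_mem (mul_mem ha hd) (mul_mem hb hc), by ring⟩
    obtain ⟨a, ha, b, hb, rfl⟩ := key x hx'
    exact map_add_mul_mem_padicValues hv hp2 hF hs hvs ha hb

theorem exists_field_with_sqrts (hv : ExtendsPadic p v) (hp2 : p ≠ 2)
    {F : IntermediateField ℚ Qbar} (hF : ∀ x ∈ F, v x ∈ padicValues p) (T : Finset Qbar)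
    (g : Qbar → Qbar) (hT : ∀ t ∈ T, g t ^ 2 ∈ F ∧ v (g t) ∈ padicValues p) :
    ∃ E : IntermediateField ℚ Qbar, F ≤ E ∧ (∀ t ∈ T, g t ∈ E) ∧
      ∀ x ∈ E, v x ∈ padicValues p := by
  classical
  induction T using Finset.induction_on with
  | empty => exact ⟨F, le_rfl, by simp, hF⟩
  | insert t T _ ih =>
    obtain ⟨E, hFE, hTE, hE⟩ := ih fun t ht => hT t (Finset.mem_insert_of_mem ht)
    obtain ⟨ht, hvt⟩ := hT t (Finset.mem_insert_self t T)
    obtain ⟨E', hEE', htE', hE'⟩ := exists_field_with_sqrt hv hp2 hE (hFE ht) hvt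
    refine ⟨E', hFE.trans hEE', fun u hu => ?_, hE'⟩
    rcases Finset.mem_insert.1 hu with rfl | hu
    exacts [htE', hEE' (hTE u hu)]

/-! ### The fields generated by the levels are unramified at new primes -/

theorem iterate_lift_congr (hv : ExtendsPadic p v) (n : ℕ) {w z : Qbar × Qbar}
    (hw1 : v w.1 ≤ 1) (hw2 : v w.2 ≤ 1) (hz1 : v z.1 ≤ 1) (hz2 : v z.2 ≤ 1)
    (h1 : v (w.1 - z.1) < 1) (h2 : v (w.2 - z.2) < 1) :
    v ((lift^[n] w).1 - (lift^[n] z).1) < 1 := by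
  have hadd {x y : Qbar} (hx : v x ≤ 1) (hy : v y ≤ 1) : v (x + y) ≤ 1 :=
    (hv.nonarch x y).trans (max_le hx hy)
  have hsub {x y : Qbar} (hx : v x ≤ 1) (hy : v y ≤ 1) : v (x - y) ≤ 1 := by
    rw [sub_eq_add_neg]
    exact hadd hx (by rwa [v.map_neg])
  have hmul {x y : Qbar} (hx : v x ≤ 1) (hy : v y ≤ 1) : v (x * y) ≤ 1 := by
    rw [map_mul]
    exact mul_le_one₀ hx (v.nonneg _) hy
  have hmul' {x y : Qbar} (hx : v x ≤ 1) (hy : v y < 1) : v (x * y) < 1 := by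
    rw [map_mul]
    exact mul_lt_one_of_nonneg_of_lt_one_right hx (v.nonneg _) hy
  have h3 : v 3 ≤ 1 := by simpa using hv.map_int_le_one 3
  have h4 : v 4 ≤ 1 := by simpa using hv.map_int_le_one 4
  induction n generalizing w z with
  | zero => exact h1
  | succ n ih =>
    have hl {w : Qbar × Qbar} (hw1 : v w.1 ≤ 1) (hw2 : v w.2 ≤ 1) :
        v (lift w).1 ≤ 1 ∧ v (lift w).2 ≤ 1 := by
      simp only [lift, sq]
      exact ⟨hadd (hmul hw2 hw2) (hmul h3 (hmul hw1 hw1)),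
        hsub (hsub (hmul hw2 hw2) (hmul (hmul h4 hw1) hw2)) (hmul hw1 hw1)⟩
    refine ih (hl hw1 hw2).1 (hl hw1 hw2).2 (hl hz1 hz2).1 (hl hz1 hz2).2 ?_ ?_
    · rw [show (lift w).1 - (lift z).1 = (w.2 + z.2) * (w.2 - z.2) +
        3 * (w.1 + z.1) * (w.1 - z.1) by simp only [lift]; ring]
      exact (hv.nonarch _ _).trans_lt
        (max_lt (hmul' (hadd hw2 hz2) h2) (hmul' (hmul h3 (hadd hw1 hz1)) h1))
    · rw [show (lift w).2 - (lift z).2 = (w.2 + z.2 - 4 * w.1) * (w.2 - z.2) +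
        (-(4 * z.2) - w.1 - z.1) * (w.1 - z.1) by simp only [lift]; ring]
      refine (hv.nonarch _ _).trans_lt
        (max_lt (hmul' (hsub (hadd hw2 hz2) (hmul h4 hw1)) h2) (hmul' (hsub (hsub ?_ hw1) hz1) h1))
      rw [v.map_neg]
      exact hmul h4 hz2

theorem fst_iterate_lift_eq_zero {n : ℕ} {β : Qbar} (hβ : β ∈ layer n) (c : Qbar) :
    (lift^[n] (c • ((β, 1) : Qbar × Qbar))).1 = 0 := by
  obtain ⟨d, hd⟩ := exists_iterate_lift_smul c n ((β, 1) : Qbar × Qbar)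
  rw [hd, Prod.smul_fst, ← prod_layer_linear n (β, 1),
    Finset.prod_eq_zero hβ (by ring), mul_zero, smul_zero]

/-- At a prime of good reduction that does not divide `a_n`, no point of the `n`-th level is
congruent to one of the branch points `3/5` and `-1`, so the discriminants on this level have
even valuation. -/
theorem map_sqrtDisc_mem_padicValues (hv : ExtendsPadic p v) (hp2 : p ≠ 2) (hp5 : p ≠ 5) {n : ℕ}
    (hn : ¬ (p : ℤ) ∣ critNum n) {β : Qbar} (hβ : β ∈ layer n) (hvβ : v β ∈ padicValues p) :
    v (sqrtDisc β) ∈ padicValues p := by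
  have hsq : v (sqrtDisc β) ^ 2 = v (5 * β - 3) * v (β + 1) := by
    rw [← map_pow, sqrtDisc_sq, disc, map_mul]
  have h3 : v 3 ≤ 1 := by simpa using hv.map_int_le_one 3
  have h5 : v 5 = 1 := by
    have : v ((5 : ℤ) : Qbar) = 1 := hv.map_int_eq_one fun h =>
      hp5 ((Nat.prime_dvd_prime_iff_eq hp.out Nat.prime_five).1 (by exact_mod_cast h))
    simpa using this
  rcases le_or_gt (v β) 1 with hle | hgt
  · have h5β : v (5 * β) ≤ 1 := by rw [map_mul, h5, one_mul]; exact hle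
    have e1 : v (5 * β - 3) = 1 := by
      refine le_antisymm ?_ (le_of_not_gt fun hlt => hn ?_)
      · rw [sub_eq_add_neg]
        exact (hv.nonarch _ _).trans (max_le h5β (by rwa [v.map_neg]))
      · refine hv.dvd_of_map_int_lt_one ?_
        have := iterate_lift_congr hv n (w := (5 : Qbar) • ((β, 1) : Qbar × Qbar)) (z := (3, 5))
          (by simpa using h5β) (by simp [h5]) h3 h5.le (by simpa using hlt) (by simp)
        rwa [fst_iterate_lift_eq_zero hβ, zero_sub, v.map_neg, ← cast_critNum] at this
    have e2 : v (β + 1) = 1 := by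
      refine le_antisymm ((hv.nonarch _ _).trans (max_le hle (by simp))) (le_of_not_gt fun hlt =>
        not_dvd_fst_iterate_lift_neg_one hp.out hp2 n ?_)
      refine hv.dvd_of_map_int_lt_one ?_
      have := iterate_lift_congr hv n (w := (1 : Qbar) • ((β, 1) : Qbar × Qbar)) (z := (-1, 1))
          (by simpa using hle) (by simp) (by simp) (by simp) (by simpa using hlt) (by simp)
      rw [fst_iterate_lift_eq_zero hβ, zero_sub, v.map_neg] at this
      have hm := iterate_lift_map (Int.castRingHom Qbar) n (-1, 1)
      rw [Prod.map_apply, map_neg, map_one] at hm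
      rw [hm] at this
      exact this
    rw [e1, e2, one_mul, pow_eq_one_iff_of_nonneg (v.nonneg _) two_ne_zero] at hsq
    rw [hsq]
    exact one_mem_padicValues
  · -- `β` reduces to infinity, which is not a branch point because `p ≠ 5`
    have h5β : v (5 * β) = v β := by rw [map_mul, h5, one_mul]
    have e1 : v (5 * β - 3) = v β := by
      rw [sub_eq_add_neg, hv.nonarch.add_eq_left_of_lt, h5β]
      rw [v.map_neg, h5β]
      exact h3.trans_lt hgt
    have e2 : v (β + 1) = v β := hv.nonarch.add_eq_left_of_lt (by rwa [map_one])
    rw [e1, e2, ← sq, sq_eq_sq₀ (v.nonneg _) (v.nonneg _)] at hsq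
    rwa [hsq]

theorem exists_field_containing_layer (hv : ExtendsPadic p v) (hp2 : p ≠ 2) (hp5 : p ≠ 5) (n : ℕ)
    (hn : ∀ m < n, ¬ (p : ℤ) ∣ critNum m) :
    ∃ E : IntermediateField ℚ Qbar, (∀ β ∈ layer n, β ∈ E) ∧ ∀ x ∈ E, v x ∈ padicValues p := by
  induction n with
  | zero =>
    refine ⟨⊥, fun β hβ => ?_, fun x hx => ?_⟩
    · rw [layer_zero, Finset.mem_singleton] at hβ
      rw [hβ]
      exact zero_mem _
    · obtain ⟨q, rfl⟩ := IntermediateField.mem_bot.1 hx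
      rw [hv.map_rat]
      exact padicNorm_mem_padicValues q
  | succ n ih =>
    obtain ⟨E, hβE, hE⟩ := ih fun m hm => hn m (hm.trans n.lt_succ_self)
    have h3 : (3 : Qbar) ∈ E := ofNat_mem E 3
    have h2 : (2 : Qbar) ∈ E := ofNat_mem E 2
    have h5 : (5 : Qbar) ∈ E := ofNat_mem E 5
    obtain ⟨E', hEE', hT, hE'⟩ := exists_field_with_sqrts hv hp2 hE (layer n) sqrtDisc
      fun β hβ => ⟨by
        rw [sqrtDisc_sq, disc]
        exact mul_mem (sub_mem (mul_mem h5 (hβE β hβ)) h3) (add_mem (hβE β hβ) (one_mem E)),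
        map_sqrtDisc_mem_padicValues hv hp2 hp5 (hn n n.lt_succ_self) hβ (hE β (hβE β hβ))⟩
    refine ⟨E', fun x hx => ?_, hE'⟩
    obtain ⟨β, hβ, hx⟩ := mem_layer_succ.1 hx
    have hβ' := hEE' (hβE β hβ)
    have hs := hT β hβ
    rcases hx with rfl | rfl
    · exact div_mem (add_mem (mul_mem (neg_mem (hEE' h2)) hβ') hs) (add_mem (hEE' h3) hβ')
    · exact div_mem (sub_mem (mul_mem (neg_mem (hEE' h2)) hβ') hs) (add_mem (hEE' h3) hβ')

end Values

/-- A new prime factor of odd multiplicity of `a_n` ramifies in the field generated by the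
square root of the product of the discriminants, but not in the field of the `n`-th level. -/
theorem prod_sqrtDisc_notMem_adjoin (n : ℕ) :
    ∏ β ∈ layer n, sqrtDisc β ∉ IntermediateField.adjoin ℚ (layer n : Set Qbar) := by
  intro hmem
  obtain ⟨p, hp, hp2, hodd⟩ := exists_prime_odd_padicValInt_critNum n
  have := Fact.mk hp
  have hdvd : (p : ℤ) ∣ critNum n := by
    by_contra h
    rw [padicValInt.eq_zero_of_not_dvd h] at hodd
    simp at hodd
  have hp5 : p ≠ 5 := by
    rintro rfl
    apply not_isSquare_critNum_mod_five n
    rw [(ZMod.intCast_zmod_eq_zero_iff_dvd _ 5).2 hdvd]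
    exact IsSquare.zero
  obtain ⟨v, hv⟩ := exists_extendsPadic p
  obtain ⟨E, hβE, hE⟩ := exists_field_containing_layer hv hp2 hp5 n
    fun m hm => not_dvd_critNum_of_lt hp hp2 hm hdvd
  have hval := hE _ (IntermediateField.adjoin_le_iff.2 hβE hmem)
  have hp0 : (p : ℝ) ≠ 0 := Nat.cast_ne_zero.2 hp.ne_zero
  have hne : ∏ β ∈ layer n, sqrtDisc β ≠ 0 :=
    Finset.prod_ne_zero_iff.2 fun β hβ => sqrtDisc_ne_zero hβ
  obtain ⟨k, hk⟩ := hval.resolve_left (v.ne_zero_iff.2 hne)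
  obtain ⟨c, hc, hprod⟩ := prod_disc n
  have hsq : v (∏ β ∈ layer n, sqrtDisc β) ^ 2 =
      (padicNorm p (critNum n * (lift^[n] ((-1, 1) : ℤ × ℤ)).1 / c ^ 2) : ℝ) := by
    rw [← map_pow, ← Finset.prod_pow, Finset.prod_congr rfl fun β _ => sqrtDisc_sq β, hprod,
      hv.map_rat]
  obtain ⟨z, hz⟩ := padicNorm.values_discrete (p := p) hc
  have hcrit : padicNorm p (critNum n) = (p : ℚ) ^ (-(padicValInt p (critNum n) : ℤ)) := by
    rw [padicNorm.eq_zpow_of_nonzero (by exact_mod_cast (critNum_pos n).ne'), padicValRat.of_int]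
  rw [padicNorm.div, padicNorm.mul,
    (padicNorm.int_eq_one_iff _).2 (not_dvd_fst_iterate_lift_neg_one hp hp2 n), sq c,
    padicNorm.mul, hz, hk, hcrit] at hsq
  push_cast at hsq
  rw [mul_one, ← zpow_natCast, ← zpow_mul, ← zpow_add₀ hp0, ← zpow_sub₀ hp0,
    zpow_right_inj₀ (by exact_mod_cast hp.pos) (by exact_mod_cast hp.one_lt.ne')] at hsq
  obtain ⟨t, ht⟩ := hodd
  push_cast [ht] at hsq
  omega

/-! ### The Galois group acts on each level by all sign changes -/

open Classical in
/-- The Kummer character of `sqrtDisc β`, with values in `ℤ/2`: it records whether `τ`, assumed to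
fix `β`, changes the sign of `sqrtDisc β`. -/
noncomputable def signChar (β : Qbar) (τ : Qbar ≃ₐ[ℚ] Qbar) : ZMod 2 :=
  if τ (sqrtDisc β) = sqrtDisc β then 0 else 1

/-- `τ` fixes the `n`-th level pointwise. -/
def FixesLayer (n : ℕ) (τ : Qbar ≃ₐ[ℚ] Qbar) : Prop := ∀ β ∈ layer n, τ β = β

theorem signChar_eq_zero_or_one {n : ℕ} {β : Qbar} (hβ : β ∈ layer n) {τ : Qbar ≃ₐ[ℚ] Qbar}
    (hτ : FixesLayer n τ) :
    (signChar β τ = 0 ∧ τ (sqrtDisc β) = sqrtDisc β) ∨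
      (signChar β τ = 1 ∧ τ (sqrtDisc β) = -sqrtDisc β) := by
  by_cases h : τ (sqrtDisc β) = sqrtDisc β
  · exact Or.inl ⟨if_pos h, h⟩
  · have := map_sqrtDisc τ β
    rw [hτ β hβ] at this
    exact Or.inr ⟨if_neg h, this.resolve_left h⟩

theorem neg_sqrtDisc_ne {n : ℕ} {β : Qbar} (hβ : β ∈ layer n) : -sqrtDisc β ≠ sqrtDisc β :=
  fun h => sqrtDisc_ne_zero hβ (neg_eq_self.1 h)

theorem signChar_mul {n : ℕ} {β : Qbar} (hβ : β ∈ layer n) {σ τ : Qbar ≃ₐ[ℚ] Qbar}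
    (hσ : FixesLayer n σ) (hτ : FixesLayer n τ) :
    signChar β (σ * τ) = signChar β σ + signChar β τ := by
  have hne := neg_sqrtDisc_ne hβ
  rcases signChar_eq_zero_or_one hβ hσ with ⟨h1, h1'⟩ | ⟨h1, h1'⟩ <;>
  rcases signChar_eq_zero_or_one hβ hτ with ⟨h2, h2'⟩ | ⟨h2, h2'⟩ <;>
  rw [h1, h2, signChar, AlgEquiv.mul_apply, h2'] <;> simp [h1', hne]
  decide

/-- The Kummer characters of conjugate vertices are conjugate. -/
theorem signChar_map (β : Qbar) (σ τ : Qbar ≃ₐ[ℚ] Qbar) :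
    signChar (σ β) τ = signChar β (σ⁻¹ * τ * σ) := by
  have h : (τ (sqrtDisc (σ β)) = sqrtDisc (σ β)) ↔
      ((σ⁻¹ * τ * σ) (sqrtDisc β) = sqrtDisc β) := by
    rw [AlgEquiv.mul_apply, AlgEquiv.mul_apply, AlgEquiv.aut_inv, AlgEquiv.symm_apply_eq]
    rcases map_sqrtDisc σ β with h | h <;> rw [h]
    rw [map_neg, neg_inj]
  classical exact if_congr h rfl rfl

/-- A combination of Kummer characters on the `n`-th level with coefficients `c` that vanishes on
the Galois group of the field of this level. By Kummer theory this says that the product of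
the discriminants with exponents `c` is a square in the field. -/
def IsRelation (n : ℕ) (c : Qbar → ZMod 2) : Prop :=
  ∀ τ, FixesLayer n τ → ∑ β ∈ layer n, c β * signChar β τ = 0

theorem IsRelation.congr {n : ℕ} {c d : Qbar → ZMod 2} (hc : IsRelation n c)
    (h : ∀ β ∈ layer n, c β = d β) : IsRelation n d := fun τ hτ => by
  rw [← hc τ hτ]
  exact Finset.sum_congr rfl fun β hβ => by rw [h β hβ]

theorem IsRelation.add {n : ℕ} {c d : Qbar → ZMod 2} (hc : IsRelation n c)
    (hd : IsRelation n d) : IsRelation n (c + d) := fun τ hτ => by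
  simp only [Pi.add_apply, add_mul, Finset.sum_add_distrib, hc τ hτ, hd τ hτ, add_zero]

theorem IsRelation.comp_map {n : ℕ} {c : Qbar → ZMod 2} (hc : IsRelation n c)
    (σ : Qbar ≃ₐ[ℚ] Qbar) : IsRelation n (c ∘ σ) := fun τ hτ => by
  have hτ' : FixesLayer n (σ * τ * σ⁻¹) := fun β hβ => by
    rw [AlgEquiv.mul_apply, AlgEquiv.mul_apply, hτ _ (map_mem_layer _ hβ), ← AlgEquiv.mul_apply,
      mul_inv_cancel, AlgEquiv.one_apply]
  rw [← hc _ hτ']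
  refine Finset.sum_bij (fun β _ => σ β) (fun β hβ => map_mem_layer σ hβ)
    (fun _ _ _ _ h => σ.injective h)
    (fun β hβ => ⟨σ.symm β, map_mem_layer σ.symm hβ, σ.apply_symm_apply β⟩) fun β hβ => ?_
  rw [signChar_map, Function.comp_apply]
  congr 2
  group

/-- The sign changes realized on the `n`-th level form a subspace of `(ℤ/2)^V`. If it is proper,
it lies in a hyperplane, which is a nonzero relation. -/
theorem exists_isRelation_of_not_surjective {n : ℕ} {ε : Qbar → ZMod 2}
    (h : ¬ ∃ τ, FixesLayer n τ ∧ ∀ β ∈ layer n, signChar β τ = ε β) :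
    ∃ c : Qbar → ZMod 2, IsRelation n c ∧ ∃ β ∈ layer n, c β ≠ 0 := by
  classical
  let A : AddSubgroup (layer n → ZMod 2) :=
    { carrier := {f | ∃ τ, FixesLayer n τ ∧ ∀ β : layer n, signChar β τ = f β}
      zero_mem' := ⟨1, fun _ _ => rfl, fun _ => if_pos rfl⟩
      add_mem' := by
        rintro f g ⟨σ, hσ, hf⟩ ⟨τ, hτ, hg⟩
        refine ⟨σ * τ, fun β hβ => ?_, fun β => ?_⟩
        · rw [AlgEquiv.mul_apply, hτ β hβ, hσ β hβ]
        · rw [signChar_mul β.2 hσ hτ, hf, hg, Pi.add_apply]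
      neg_mem' := by
        rintro f hf
        rwa [show -f = f from funext fun β => ZMod.neg_eq_self_mod_two (f β)] }
  have hlt : AddSubgroup.toZModSubmodule 2 A < ⊤ := by
    rw [lt_top_iff_ne_top]
    intro htop
    have hε : (fun β : layer n => ε β) ∈ AddSubgroup.toZModSubmodule 2 A := by
      rw [htop]; trivial
    obtain ⟨τ, hτ, hτε⟩ := hε
    exact h ⟨τ, hτ, fun β hβ => hτε ⟨β, hβ⟩⟩
  obtain ⟨f, hf, hle⟩ := Submodule.exists_le_ker_of_lt_top _ hlt
  have hfe (g : layer n → ZMod 2) : f g = ∑ β, f (Pi.single β 1) * g β := by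
    conv_lhs => rw [LinearMap.pi_apply_eq_sum_univ f g]
    exact Finset.sum_congr rfl fun β _ => by
      rw [smul_eq_mul, mul_comm]
      congr 3 with j
      simp [Pi.single_apply, eq_comm]
  let c : Qbar → ZMod 2 := fun β => if hβ : β ∈ layer n then f (Pi.single ⟨β, hβ⟩ 1) else 0
  have hcβ (β : layer n) : c β = f (Pi.single β 1) := dif_pos β.2
  refine ⟨c, fun τ hτ => ?_, ?_⟩
  · have : f (fun β : layer n => signChar β τ) = 0 := hle ⟨τ, hτ, fun _ => rfl⟩
    rw [hfe] at this
    rw [← Finset.sum_coe_sort, ← this]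
    exact Finset.sum_congr rfl fun β _ => by rw [hcβ]
  · by_contra! hall
    refine hf (LinearMap.ext fun g => ?_)
    rw [hfe g]
    exact Finset.sum_eq_zero fun β _ => by rw [← hcβ, hall β β.2, zero_mul]

/-- The constant function is not a relation: otherwise the product of all `sqrtDisc β` would lie
in the field of the `n`-th level. -/
theorem not_isRelation_one (n : ℕ) : ¬ IsRelation n fun _ => 1 := by
  classical
  intro hrel
  apply prod_sqrtDisc_notMem_adjoin n
  rw [← InfiniteGalois.fixedField_fixingSubgroup
    (IntermediateField.adjoin ℚ (layer n : Set Qbar))]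
  rw [IntermediateField.mem_fixedField_iff]
  intro τ hτ
  have hτ' : FixesLayer n τ := fun β hβ =>
    (IntermediateField.mem_fixingSubgroup_iff _ _).1 hτ β
      (IntermediateField.subset_adjoin ℚ _ hβ)
  have key : ∀ T ⊆ layer n,
      (∑ β ∈ T, signChar β τ = 0 ∧ τ (∏ β ∈ T, sqrtDisc β) = ∏ β ∈ T, sqrtDisc β) ∨
      (∑ β ∈ T, signChar β τ = 1 ∧ τ (∏ β ∈ T, sqrtDisc β) = -∏ β ∈ T, sqrtDisc β) := by
    intro T hT
    induction T using Finset.induction_on with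
    | empty => simp
    | insert β T hβ ih =>
      rw [Finset.insert_subset_iff] at hT
      rw [Finset.sum_insert hβ, Finset.prod_insert hβ, map_mul]
      rcases signChar_eq_zero_or_one hT.1 hτ' with ⟨h1, h1'⟩ | ⟨h1, h1'⟩ <;>
      rcases ih hT.2 with ⟨h2, h2'⟩ | ⟨h2, h2'⟩ <;>
      rw [h1, h2, h1', h2']
      · simp
      · simp
      · simp
      · left; exact ⟨by decide, by ring⟩
  have hsum := hrel τ hτ'
  simp only [one_mul] at hsum
  rcases key _ subset_rfl with h | h
  · exact h.2
  · exact absurd (hsum.symm.trans h.1) zero_ne_one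

/-- One step down the tree. A relation pulled back from level `m + 1` that distinguishes the two
children of some `γ` is replaced by its sum with its translate under an automorphism
exchanging only these two children: the result is the pullback of the indicator of `γ`. -/
theorem exists_isRelation_descend {m n k : ℕ} (hn : n = m + 1 + k)
    (ih : ∀ ε : Qbar → ZMod 2, ∃ τ, FixesLayer m τ ∧ ∀ β ∈ layer m, signChar β τ = ε β)
    {c : Qbar → ZMod 2} (hc : IsRelation n (c ∘ phi^[k])) (hne : ∃ β ∈ layer (m + 1), c β ≠ 0) :
    ∃ d : Qbar → ZMod 2, IsRelation n (d ∘ phi^[k + 1]) ∧ ∃ β ∈ layer m, d β ≠ 0 := by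
  classical
  have hmem {β : Qbar} (hβ : β ∈ layer n) : phi^[k] β ∈ layer (m + 1) :=
    iterate_phi_mem_layer (hn ▸ hβ)
  by_cases hcase : ∀ γ ∈ layer m, c (childPos γ) = c (childNeg γ)
  · have hd : ∀ β ∈ layer (m + 1), c β = c (childPos (phi β)) := by
      intro β hβ
      rcases eq_child_of_phi_eq hβ rfl with h | h
      · rw [← h]
      · rw [hcase _ (phi_mem_layer hβ), ← h]
    refine ⟨c ∘ childPos, hc.congr fun β hβ => ?_, ?_⟩
    · simp only [Function.comp_apply, Function.iterate_succ_apply']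
      exact hd _ (hmem hβ)
    · obtain ⟨β, hβ, hcβ⟩ := hne
      exact ⟨phi β, phi_mem_layer hβ, by rwa [Function.comp_apply, ← hd β hβ]⟩
  · push Not at hcase
    obtain ⟨γ, hγ, hcγ⟩ := hcase
    obtain ⟨τ, hτ, hτε⟩ := ih (Pi.single γ 1)
    have hone {a b : ZMod 2} (h : a ≠ b) : a + b = 1 := by revert a b; decide
    have hzero (a : ZMod 2) : a + a = 0 := by revert a; decide
    refine ⟨Pi.single γ 1, (hc.add (hc.comp_map τ)).congr fun β hβ => ?_, γ, hγ, by simp⟩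
    simp only [Pi.add_apply, Function.comp_apply, Function.iterate_succ_apply', ← map_iterate_phi]
    have hx := hmem hβ
    generalize phi^[k] β = x at hx
    have hδ := phi_mem_layer hx
    have hchild := eq_child_of_phi_eq hx rfl
    generalize phi x = δ at hδ hchild
    have hs := hτε δ hδ
    by_cases hδγ : δ = γ
    · subst hδγ
      rw [Pi.single_eq_same] at hs ⊢
      rcases signChar_eq_zero_or_one hδ hτ with ⟨h0, -⟩ | ⟨-, h⟩
      · exact absurd (h0.symm.trans hs) zero_ne_one
      · obtain ⟨h1, h2⟩ := map_childPos τ (hτ δ hδ) h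
        rcases hchild with rfl | rfl
        · rw [h1]; exact hone hcγ
        · rw [h2]; exact hone hcγ.symm
    · rw [Pi.single_eq_of_ne hδγ] at hs ⊢
      rcases signChar_eq_zero_or_one hδ hτ with ⟨-, h⟩ | ⟨h0, -⟩
      · obtain ⟨h1, h2⟩ := map_childPos_of_fixed τ (hτ δ hδ) h
        rcases hchild with rfl | rfl
        · rw [h1]; exact hzero _
        · rw [h2]; exact hzero _
      · exact absurd (hs.symm.trans h0) zero_ne_one

/-- Every system of sign changes of the `sqrtDisc β` on the `n`-th level is realized by an
automorphism that fixes this level pointwise. -/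
theorem exists_signChar_eq (n : ℕ) (ε : Qbar → ZMod 2) :
    ∃ τ, FixesLayer n τ ∧ ∀ β ∈ layer n, signChar β τ = ε β := by
  induction n using Nat.strong_induction_on generalizing ε with
  | _ n ih =>
    by_contra hcon
    have key : ∀ k m, n = m + k →
        ∃ c : Qbar → ZMod 2, IsRelation n (c ∘ phi^[k]) ∧ ∃ β ∈ layer m, c β ≠ 0 := by
      intro k
      induction k with
      | zero =>
        rintro m rfl
        exact exists_isRelation_of_not_surjective hcon
      | succ k ihk =>
        intro m hm
        have hm' : n = m + 1 + k := by omega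
        obtain ⟨c, hc, hne⟩ := ihk (m + 1) hm'
        exact exists_isRelation_descend hm' (fun ε => ih m (by omega) ε) hc hne
    obtain ⟨c, hc, β, hβ, hne⟩ := key n 0 (by omega)
    rw [layer_zero, Finset.mem_singleton] at hβ
    subst hβ
    refine not_isRelation_one n (hc.congr fun x hx => ?_)
    have h0 : phi^[n] x ∈ layer 0 := iterate_phi_mem_layer (by rwa [zero_add])
    rw [layer_zero, Finset.mem_singleton] at h0
    rw [Function.comp_apply, h0]
    generalize c 0 = a at hne
    revert a
    decide

/-! ### Tree automorphisms are induced by Galois automorphisms -/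

/-- A map that acts on the levels like an automorphism of the rooted tree. -/
structure IsTreeMap (E : Qbar → Qbar) : Prop where
  map_mem : ∀ n, ∀ x ∈ layer n, E x ∈ layer n
  phi_map : ∀ n, ∀ x ∈ layer (n + 1), phi (E x) = E (phi x)
  injOn : ∀ n, Set.InjOn E (layer n)

theorem IsTreeMap.exists_algEquiv_eqOn_layer {E : Qbar → Qbar} (hE : IsTreeMap E) (n : ℕ) :
    ∃ σ : Qbar ≃ₐ[ℚ] Qbar, ∀ x ∈ layer n, σ x = E x := by
  classical
  induction n with
  | zero =>
    refine ⟨1, fun x hx => ?_⟩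
    have h := hE.map_mem 0 x hx
    rw [layer_zero, Finset.mem_singleton] at hx h
    rw [h, hx, map_zero]
  | succ n ih =>
    obtain ⟨σ, hσ⟩ := ih
    -- `τ` exchanges the children of `β` exactly when `σ` and `E` disagree on them
    obtain ⟨τ, hτ, hτε⟩ := exists_signChar_eq n
      fun β => if σ (childPos β) = E (childPos β) then 0 else 1
    refine ⟨σ * τ, fun x hx => ?_⟩
    rw [AlgEquiv.mul_apply]
    have hβ := phi_mem_layer hx
    have hchild := eq_child_of_phi_eq hx rfl
    generalize phi x = β at hβ hchild
    have hP := childPos_mem_layer hβ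
    have hN := childNeg_mem_layer hβ
    have hne := childPos_ne_childNeg hβ
    have e1 := eq_child_of_phi_eq (hE.map_mem _ _ hP) (by rw [hE.phi_map _ _ hP, phi_childPos hβ])
    have e2 := eq_child_of_phi_eq (hE.map_mem _ _ hN) (by rw [hE.phi_map _ _ hN, phi_childNeg hβ])
    have e3 := eq_child_of_phi_eq (map_mem_layer σ hP)
      (by rw [← map_phi, phi_childPos hβ, hσ β hβ])
    have e4 := eq_child_of_phi_eq (map_mem_layer σ hN)
      (by rw [← map_phi, phi_childNeg hβ, hσ β hβ])
    have hEne : E (childPos β) ≠ E (childNeg β) := (hE.injOn _).ne hP hN hne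
    have hσne : σ (childPos β) ≠ σ (childNeg β) := σ.injective.ne hne
    have hs := hτε β hβ
    by_cases heq : σ (childPos β) = E (childPos β)
    · rw [if_pos heq] at hs
      obtain ⟨h1, h2⟩ := map_childPos_of_fixed τ (hτ β hβ) <| by
        rcases signChar_eq_zero_or_one hβ hτ with ⟨-, h⟩ | ⟨h, -⟩
        · exact h
        · exact absurd (hs.symm.trans h) zero_ne_one
      rcases hchild with rfl | rfl
      · rw [h1, heq]
      · rw [h2]
        grind
    · rw [if_neg heq] at hs
      obtain ⟨h1, h2⟩ := map_childPos τ (hτ β hβ) <| by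
        rcases signChar_eq_zero_or_one hβ hτ with ⟨h, -⟩ | ⟨-, h⟩
        · exact absurd (h.symm.trans hs) zero_ne_one
        · exact h
      rcases hchild with rfl | rfl
      · rw [h1]
        grind
      · rw [h2]
        grind

theorem isClosed_setOf_map_eq (x y : Qbar) : IsClosed {σ : Qbar ≃ₐ[ℚ] Qbar | σ x = y} := by
  by_cases h : ∃ σ₀ : Qbar ≃ₐ[ℚ] Qbar, σ₀ x = y
  · obtain ⟨σ₀, rfl⟩ := h
    have hst : IsClosed (MulAction.stabilizer (Qbar ≃ₐ[ℚ] Qbar) x : Set (Qbar ≃ₐ[ℚ] Qbar)) :=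
      Subgroup.isClosed_of_isOpen _ (stabilizer_isOpen_of_isIntegral x)
    convert hst.preimage (continuous_const_mul σ₀⁻¹) using 1
    ext σ
    simp only [Set.mem_ofPred_eq, Set.mem_preimage, SetLike.mem_coe, MulAction.mem_stabilizer_iff,
      AlgEquiv.smul_def, AlgEquiv.mul_apply, AlgEquiv.aut_inv]
    rw [AlgEquiv.symm_apply_eq]
  · convert isClosed_empty
    ext σ
    exact ⟨fun hσ => h ⟨σ, hσ⟩, False.elim⟩

/-- Approximations on the finite levels yield an automorphism, by compactness of the absolute
Galois group. -/
theorem IsTreeMap.exists_algEquiv_eq {E : Qbar → Qbar} (hE : IsTreeMap E) :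
    ∃ σ : Qbar ≃ₐ[ℚ] Qbar, ∀ n, ∀ x ∈ layer n, σ x = E x := by
  let S : ℕ → Set (Qbar ≃ₐ[ℚ] Qbar) := fun n => {σ | ∀ x ∈ layer n, σ x = E x}
  have hclosed (n : ℕ) : IsClosed (S n) := by
    have : S n = ⋂ x ∈ layer n, {σ : Qbar ≃ₐ[ℚ] Qbar | σ x = E x} := by
      ext σ
      simp [S]
    rw [this]
    exact isClosed_biInter fun x _ => isClosed_setOf_map_eq x (E x)
  have hanti (n : ℕ) : S (n + 1) ⊆ S n := by
    intro σ hσ β hβ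
    have hP := childPos_mem_layer hβ
    have := congrArg phi (hσ _ hP)
    rwa [← map_phi, hE.phi_map n _ hP, phi_childPos hβ] at this
  obtain ⟨σ, hσ⟩ := IsCompact.nonempty_iInter_of_sequence_nonempty_isCompact_isClosed S hanti
    hE.exists_algEquiv_eqOn_layer (hclosed 0).isCompact hclosed
  exact ⟨σ, fun n => Set.mem_iInter.1 hσ n⟩

/-! ### The rational function as a self-map of the projective line -/

/-- The rational function `φ`. -/
noncomputable def ratPhi : RatFunc ℚ :=
  (1 + 3 * RatFunc.X ^ 2) / (1 - 4 * RatFunc.X - RatFunc.X ^ 2)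

open Polynomial in
theorem num_denom_ratPhi :
    ratPhi.num = -(1 + 3 * X ^ 2) ∧ ratPhi.denom = X ^ 2 + 4 * X - 1 := by
  have hmon : (X ^ 2 + 4 * X - 1 : ℚ[X]).Monic := by
    rw [show (X ^ 2 + 4 * X - 1 : ℚ[X]) = X ^ 2 + C 4 * X + C (-1) by
      rw [C_neg, C_1, show (C (4 : ℚ)) = 4 from rfl]; ring]
    monicity!
  have h : ratPhi = algebraMap ℚ[X] (RatFunc ℚ) (-(1 + 3 * X ^ 2)) /
      algebraMap ℚ[X] (RatFunc ℚ) (X ^ 2 + 4 * X - 1) := by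
    rw [ratPhi, ← neg_div_neg_eq]
    simp only [map_neg, map_add, map_sub, map_mul, map_pow, map_one, map_ofNat,
      RatFunc.algebraMap_X]
    congr 1
    ring
  have hcop : IsCoprime (-(1 + 3 * X ^ 2) : ℚ[X]) (X ^ 2 + 4 * X - 1) := by
    have h16 : (C (1 / 16) : ℚ[X]) * 16 = 1 := by
      rw [show (16 : ℚ[X]) = C 16 from rfl, ← C_mul, ← C_1]
      norm_num
    refine ⟨C (1 / 16) * -(3 * X + 13), C (1 / 16) * (-9 * X - 3), ?_⟩
    linear_combination h16
  have heq := (RatFunc.num_mul_eq_mul_denom_iff hmon.ne_zero).2 h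
  have hden : ratPhi.denom = X ^ 2 + 4 * X - 1 := by
    refine eq_of_monic_of_associated ratPhi.monic_denom hmon (associated_of_dvd_dvd ?_ ?_)
    · rw [h]
      exact RatFunc.denom_div_dvd _ _
    · exact hcop.symm.dvd_of_dvd_mul_left (heq ▸ dvd_mul_left _ _)
  refine ⟨?_, hden⟩
  rw [hden] at heq
  exact mul_right_cancel₀ hmon.ne_zero heq

open Classical in
theorem ratMap_coe (x : Qbar) :
    Arboreal.ratMap Qbar ratPhi (x : OnePoint Qbar) =
      if 1 - 4 * x - x ^ 2 = 0 then ∞ else ((phi x : Qbar) : OnePoint Qbar) := by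
  obtain ⟨hn, hd⟩ := num_denom_ratPhi
  have hn' : Polynomial.aeval x ratPhi.num = -(1 + 3 * x ^ 2) := by simp [hn, map_ofNat]
  have hd' : Polynomial.aeval x ratPhi.denom = -(1 - 4 * x - x ^ 2) := by
    rw [hd]
    simp only [map_sub, map_add, map_mul, map_pow, map_one, map_ofNat, Polynomial.aeval_X]
    ring
  simp only [Arboreal.ratMap, hn', hd', neg_div_neg_eq, neg_eq_zero, phi]

theorem ratMap_infty : Arboreal.ratMap Qbar ratPhi ∞ = ((-3 : Qbar) : OnePoint Qbar) := by
  obtain ⟨hn, hd⟩ := num_denom_ratPhi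
  have h1 : (-(1 + 3 * Polynomial.X ^ 2) : Polynomial ℚ).coeff 2 = -3 := by
    simp [Polynomial.coeff_one]
  have h2 : (Polynomial.X ^ 2 + 4 * Polynomial.X - 1 : Polynomial ℚ).coeff 2 = 1 := by
    simp [Polynomial.coeff_one, Polynomial.coeff_X]
  have h3 : (-(1 + 3 * Polynomial.X ^ 2) : Polynomial ℚ).natDegree ≤ 2 := by compute_degree
  have h4 : (Polynomial.X ^ 2 + 4 * Polynomial.X - 1 : Polynomial ℚ).natDegree = 2 := by
    refine Polynomial.natDegree_eq_of_le_of_coeff_ne_zero (by compute_degree) ?_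
    rw [h2]
    exact one_ne_zero
  have hdeg : Arboreal.ratDegree ratPhi = 2 := by
    rw [Arboreal.ratDegree, hn, hd, h4, max_eq_right h3]
  simp only [Arboreal.ratMap, hdeg]
  rw [hn, hd, h1, h2, if_neg one_ne_zero, div_one, map_neg, map_ofNat]

theorem ratMap_eq_coe_iff {x β : Qbar} :
    Arboreal.ratMap Qbar ratPhi (x : OnePoint Qbar) = (β : OnePoint Qbar) ↔
      1 - 4 * x - x ^ 2 ≠ 0 ∧ phi x = β := by
  rw [ratMap_coe]
  split_ifs with h <;> simp [h]

/-- No vertex is at infinity, and the levels of the tree are the sets `layer n`. -/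
theorem level_eq (n : ℕ) :
    Arboreal.level ratPhi 0 n = (fun x : Qbar => (x : OnePoint Qbar)) '' (layer n : Set Qbar) := by
  induction n with
  | zero =>
    ext β
    simp [Arboreal.level, Arboreal.basePoint, layer_zero]
  | succ n ih =>
    ext β
    have h : β ∈ Arboreal.level ratPhi 0 (n + 1) ↔
        Arboreal.ratMap Qbar ratPhi β ∈ Arboreal.level ratPhi 0 n := Iff.rfl
    rw [h, ih]
    constructor
    · rintro ⟨γ, hγ, hβ⟩
      induction β using OnePoint.rec with
      | infty =>
        rw [ratMap_infty] at hβ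
        have := three_add_ne_zero hγ
        rw [OnePoint.coe_injective hβ] at this
        simp at this
      | coe x =>
        obtain ⟨hd, rfl⟩ := ratMap_eq_coe_iff.1 hβ.symm
        exact ⟨x, mem_layer_succ_iff_phi_mem.2 ⟨hd, hγ⟩, rfl⟩
    · rintro ⟨x, hx, rfl⟩
      obtain ⟨hd, hx⟩ := mem_layer_succ_iff_phi_mem.1 hx
      exact ⟨phi x, hx, (ratMap_eq_coe_iff.2 ⟨hd, rfl⟩).symm⟩

/-! ### The map is not conjugate to a polynomial -/

/-- A fixed point has a preimage other than itself: otherwise it would be one of the branch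
points `3/5` and `-1`, which are not fixed. -/
theorem exists_ratMap_eq_ne {z : OnePoint Qbar} (hz : Arboreal.ratMap Qbar ratPhi z = z) :
    ∃ y ≠ z, Arboreal.ratMap Qbar ratPhi y = z := by
  induction z using OnePoint.rec with
  | infty => simp [ratMap_infty] at hz
  | coe z =>
    obtain ⟨-, hfix⟩ := ratMap_eq_coe_iff.1 hz
    have h3 : 3 + z ≠ 0 := by
      intro h
      rw [eq_neg_of_add_eq_zero_right h, phi] at hfix
      norm_num at hfix
    by_contra! hall
    have hP : childPos z = z := by
      by_contra hne
      exact hall (childPos z) (by simpa using hne) (ratMap_eq_coe_iff.2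
        (preimage_iff_phi_eq.1 ((preimage_iff_eq_child h3).2 (Or.inl rfl))))
    have hN : childNeg z = z := by
      by_contra hne
      exact hall (childNeg z) (by simpa using hne) (ratMap_eq_coe_iff.2
        (preimage_iff_phi_eq.1 ((preimage_iff_eq_child h3).2 (Or.inr rfl))))
    have h0 : sqrtDisc z = 0 := by
      have h := hP.trans hN.symm
      rw [childPos, childNeg, div_left_inj' h3] at h
      have h2 : 2 * sqrtDisc z = 0 := by linear_combination h
      simpa using h2
    have hdisc := sqrtDisc_sq z
    rw [h0, disc, zero_pow two_ne_zero, eq_comm, mul_eq_zero] at hdisc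
    rcases hdisc with h | h
    · have hz : z = 3 / 5 := by rw [eq_div_iff (by norm_num)]; linear_combination h
      rw [hz, phi] at hfix
      norm_num at hfix
    · rw [eq_neg_of_add_eq_zero_left h, phi] at hfix
      norm_num at hfix

theorem ratMap_polynomial_coe {K : Type*} [Field K] (f : Polynomial K) (x : K) :
    Arboreal.ratMap K (algebraMap (Polynomial K) (RatFunc K) f) (x : OnePoint K) =
      ((f.eval x : K) : OnePoint K) := by
  simp [Arboreal.ratMap]

theorem ratMap_polynomial_infty {K : Type*} [Field K] (f : Polynomial K) (hf : f.natDegree ≠ 0) :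
    Arboreal.ratMap K (algebraMap (Polynomial K) (RatFunc K) f) ∞ = ∞ := by
  have : (1 : Polynomial K).coeff f.natDegree = 0 := by
    rw [Polynomial.coeff_one, if_neg hf]
  simp [Arboreal.ratMap, Arboreal.ratDegree, this]

theorem ratMap_polynomial_const {K : Type*} [Field K] (c : K) (x : OnePoint K) :
    Arboreal.ratMap K (algebraMap (Polynomial K) (RatFunc K) (Polynomial.C c)) x = c := by
  induction x using OnePoint.rec with
  | infty => simp [Arboreal.ratMap, Arboreal.ratDegree]
  | coe x => rw [ratMap_polynomial_coe, Polynomial.eval_C]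

open Classical in
theorem not_isConjToPolynomial :
    ¬ Arboreal.IsConjToPolynomial ratPhi := by
  rintro ⟨g, f, hg⟩
  by_cases hf : f.natDegree = 0
  · -- a constant map takes the same value at `0` and `1`
    obtain ⟨c, rfl⟩ := Polynomial.natDegree_eq_zero.1 hf
    have hconst (y : OnePoint Qbar) :
        Arboreal.ratMap Qbar ratPhi y = g⁻¹ • (c : OnePoint Qbar) := by
      have h := hg (g • y)
      rw [inv_smul_smul, ratMap_polynomial_const] at h
      exact eq_inv_smul_iff.2 h
    have h0 : Arboreal.ratMap Qbar ratPhi ((0 : Qbar) : OnePoint Qbar) =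
        ((1 : Qbar) : OnePoint Qbar) :=
      ratMap_eq_coe_iff.2 (by norm_num [phi])
    have h1 : Arboreal.ratMap Qbar ratPhi ((1 : Qbar) : OnePoint Qbar) =
        ((-1 : Qbar) : OnePoint Qbar) :=
      ratMap_eq_coe_iff.2 (by norm_num [phi])
    have h := OnePoint.coe_injective (h0.symm.trans ((hconst _).trans ((hconst _).symm.trans h1)))
    norm_num at h
  · have hfix : Arboreal.ratMap Qbar ratPhi (g⁻¹ • ∞) = g⁻¹ • ∞ := by
      rw [eq_inv_smul_iff]
      exact (hg ∞).trans (ratMap_polynomial_infty f hf)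
    obtain ⟨y, hy, hyz⟩ := exists_ratMap_eq_ne hfix
    have h := hg (g • y)
    rw [inv_smul_smul] at h
    have h' := congrArg (g • ·) hyz
    simp only [smul_inv_smul] at h'
    have h2 := h'.symm.trans h
    have hgy : g • y ≠ ∞ := fun h => hy (eq_inv_smul_iff.2 h)
    induction hx : g • y using OnePoint.rec with
    | infty => exact hgy hx
    | coe x =>
      rw [hx, ratMap_polynomial_coe] at h2
      exact OnePoint.infty_ne_coe _ h2

/-! ### The preimage tree -/

/-- The vertices of the preimage tree of `0` under `φ`. -/
abbrev Vert : Type := Arboreal.Vertex ratPhi (0 : ℚ)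

/-- The preimage tree of `0` under `φ`. -/
noncomputable abbrev tree : SimpleGraph Vert := Arboreal.preimageTree ratPhi (0 : ℚ)

theorem exists_coe_eq (v : Vert) : ∃ n, ∃ x ∈ layer n, v.1 = (x : OnePoint Qbar) := by
  obtain ⟨n, hn⟩ := Set.mem_iUnion.1 v.2
  rw [level_eq] at hn
  obtain ⟨x, hx, h⟩ := hn
  exact ⟨n, x, hx, h.symm⟩

/-- The distance of a vertex to the root. -/
noncomputable def depth (v : Vert) : ℕ := (exists_coe_eq v).choose

/-- The affine coordinate of a vertex. -/
noncomputable def coord (v : Vert) : Qbar := (exists_coe_eq v).choose_spec.choose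

theorem coord_mem_layer (v : Vert) : coord v ∈ layer (depth v) :=
  (exists_coe_eq v).choose_spec.choose_spec.1

theorem coe_coord (v : Vert) : v.1 = (coord v : OnePoint Qbar) :=
  (exists_coe_eq v).choose_spec.choose_spec.2

theorem coord_injective : Function.Injective coord := fun v w h =>
  Subtype.ext (by rw [coe_coord, coe_coord, h])

/-- The vertex with a given affine coordinate. -/
def mkVert {n : ℕ} {x : Qbar} (hx : x ∈ layer n) : Vert :=
  ⟨(x : OnePoint Qbar), Set.mem_iUnion.2 ⟨n, by rw [level_eq]; exact ⟨x, hx, rfl⟩⟩⟩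

theorem coord_mkVert {n : ℕ} {x : Qbar} (hx : x ∈ layer n) : coord (mkVert hx) = x :=
  OnePoint.coe_injective (coe_coord (mkVert hx)).symm

theorem depth_eq {v : Vert} {n : ℕ} (h : coord v ∈ layer n) : depth v = n :=
  layer_unique (coord_mem_layer v) h

/-- The vertex `w` is the parent of `v`. -/
def IsParent (v w : Vert) : Prop := Arboreal.ratMap Qbar ratPhi v.1 = w.1

theorem isParent_iff {v w : Vert} :
    IsParent v w ↔ phi (coord v) = coord w ∧ depth v = depth w + 1 := by
  rw [IsParent, coe_coord v, coe_coord w, ratMap_eq_coe_iff]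
  constructor
  · rintro ⟨hd, h⟩
    exact ⟨h, depth_eq (mem_layer_succ_iff_phi_mem.2 ⟨hd, h ▸ coord_mem_layer w⟩)⟩
  · rintro ⟨h, hd⟩
    exact ⟨(mem_layer_succ_iff_phi_mem.1 (hd ▸ coord_mem_layer v)).1, h⟩

theorem IsParent.unique {v w w' : Vert} (h : IsParent v w) (h' : IsParent v w') : w = w' :=
  Subtype.ext (h.symm.trans h')

theorem tree_adj {v w : Vert} : tree.Adj v w ↔ IsParent v w ∨ IsParent w v := by
  rw [tree, Arboreal.preimageTree, SimpleGraph.fromRel_adj]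
  change v ≠ w ∧ (IsParent v w ∨ IsParent w v) ↔ _
  refine ⟨And.right, fun h => ⟨?_, h⟩⟩
  rintro rfl
  have h : IsParent v v := h.elim id id
  have := (isParent_iff.1 h).2
  omega

theorem exists_isParent {v : Vert} {n : ℕ} (h : depth v = n + 1) :
    ∃ w, IsParent v w ∧ depth w = n := by
  have hw := phi_mem_layer (h ▸ coord_mem_layer v)
  have hd : depth (mkVert hw) = n := depth_eq (by rwa [coord_mkVert])
  exact ⟨mkVert hw, isParent_iff.2 ⟨(coord_mkVert hw).symm, by rw [h, hd]⟩, hd⟩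

theorem depth_eq_zero_iff {v : Vert} : depth v = 0 ↔ v = Arboreal.root ratPhi 0 := by
  have hroot : coord (Arboreal.root ratPhi 0) = 0 := by
    apply OnePoint.coe_injective
    rw [← coe_coord]
    change ((algebraMap ℚ Qbar 0 : Qbar) : OnePoint Qbar) = _
    rw [map_zero]
  constructor
  · intro h
    have := coord_mem_layer v
    rw [h, layer_zero, Finset.mem_singleton] at this
    exact coord_injective (this.trans hroot.symm)
  · rintro rfl
    exact depth_eq (by rw [hroot, layer_zero, Finset.mem_singleton])

theorem tree_connected : tree.Connected := by
  rw [SimpleGraph.connected_iff_exists_forall_reachable]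
  refine ⟨Arboreal.root ratPhi 0, fun v => SimpleGraph.Reachable.symm ?_⟩
  induction hn : depth v generalizing v with
  | zero => rw [depth_eq_zero_iff.1 hn]
  | succ n ih =>
    obtain ⟨w, hvw, hw⟩ := exists_isParent hn
    exact (tree_adj.2 (Or.inl hvw)).reachable.trans (ih w hw)

/-- The edge from `v` to its parent is a bridge: once it is removed, the descendants of `v` are
closed under adjacency. -/
theorem isBridge_of_isParent {v w : Vert} (hvw : IsParent v w) : tree.IsBridge s(v, w) := by
  rw [SimpleGraph.isBridge_iff]
  let D : Vert → Prop := fun u => ∃ k, phi^[k] (coord u) = coord v ∧ depth u = depth v + k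
  have hD : ∀ u u', (tree.deleteEdges {s(v, w)}).Walk u u' → D u → D u' := by
    intro u u' p
    induction p with
    | nil => exact id
    | @cons a b c hab _ ih =>
      refine fun ha => ih ?_
      rw [SimpleGraph.deleteEdges_adj, tree_adj, Set.mem_singleton_iff] at hab
      obtain ⟨hab, hne⟩ := hab
      obtain ⟨k, hk, hdk⟩ := ha
      rcases hab with hab | hab
      · cases k with
        | zero =>
          have hav : a = v := coord_injective hk
          subst hav
          exact absurd (by rw [hab.unique hvw]) hne
        | succ k =>
          obtain ⟨h1, h2⟩ := isParent_iff.1 hab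
          exact ⟨k, by rw [← h1]; exact hk, by omega⟩
      · obtain ⟨h1, h2⟩ := isParent_iff.1 hab
        exact ⟨k + 1, by rw [Function.iterate_succ_apply, h1, hk], by omega⟩
  rintro ⟨p⟩
  obtain ⟨k, -, hk⟩ := hD v w p ⟨0, rfl, rfl⟩
  have := (isParent_iff.1 hvw).2
  omega

theorem tree_isTree : tree.IsTree := by
  refine ⟨tree_connected, SimpleGraph.isAcyclic_iff_forall_adj_isBridge.2 fun v w h => ?_⟩
  rcases tree_adj.1 h with h | h
  · exact isBridge_of_isParent h
  · rw [Sym2.eq_swap]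
    exact isBridge_of_isParent h

theorem ncard_setOf_isParent (v : Vert) : {w : Vert | IsParent w v}.ncard = 2 := by
  have hv := coord_mem_layer v
  have hP := childPos_mem_layer hv
  have hN := childNeg_mem_layer hv
  have heq : {w : Vert | IsParent w v} = {mkVert hP, mkVert hN} := by
    ext w
    rw [Set.mem_ofPred_eq, Set.mem_insert_iff, Set.mem_singleton_iff, isParent_iff]
    constructor
    · rintro ⟨h, hd⟩
      rcases eq_child_of_phi_eq (hd ▸ coord_mem_layer w) h with h | h
      · exact Or.inl (coord_injective (h.trans (coord_mkVert hP).symm))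
      · exact Or.inr (coord_injective (h.trans (coord_mkVert hN).symm))
    · rintro (rfl | rfl)
      · exact ⟨by rw [coord_mkVert, phi_childPos hv], depth_eq (by rwa [coord_mkVert])⟩
      · exact ⟨by rw [coord_mkVert, phi_childNeg hv], depth_eq (by rwa [coord_mkVert])⟩
  rw [heq, Set.ncard_pair]
  intro h
  have := congrArg coord h
  rw [coord_mkVert, coord_mkVert] at this
  exact childPos_ne_childNeg hv this

/-! ### Automorphisms of the rooted tree -/

/-- An automorphism that fixes the root preserves the depth and the parent relation. -/
theorem depth_map_and_isParent_map {e : tree ≃g tree}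
    (he : e (Arboreal.root ratPhi 0) = Arboreal.root ratPhi 0) (n : ℕ) :
    ∀ v, depth v = n → depth (e v) = n ∧ ∀ w, IsParent v w → IsParent (e v) (e w) := by
  induction n with
  | zero =>
    intro v hv
    refine ⟨?_, fun w hvw => ?_⟩
    · rw [depth_eq_zero_iff.1 hv, he, depth_eq_zero_iff]
    · have := (isParent_iff.1 hvw).2
      omega
  | succ n ih =>
    intro v hv
    obtain ⟨w, hvw, hw⟩ := exists_isParent hv
    obtain ⟨hew, hup⟩ := ih w hw
    have hadj := tree_adj.1 (e.map_adj_iff.2 (tree_adj.2 (Or.inl hvw)))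
    have key : IsParent (e v) (e w) := by
      refine hadj.resolve_right fun hwv => ?_
      -- otherwise `e v` is the parent of `e w`, and hence the image of the parent of `w`
      cases n with
      | zero =>
        have := (isParent_iff.1 hwv).2
        omega
      | succ k =>
        obtain ⟨u, hwu, hu⟩ := exists_isParent hw
        have huv := e.injective (hwv.unique (hup u hwu))
        rw [huv] at hv
        omega
    refine ⟨by rw [(isParent_iff.1 key).2, hew], fun w' hw' => ?_⟩
    rw [hw'.unique hvw]
    exact key

open Classical in
/-- The map on affine coordinates induced by a map of vertices, extended by the identity. -/
noncomputable def onCoord (e : Vert → Vert) (x : Qbar) : Qbar :=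
  if h : ∃ v, coord v = x then coord (e h.choose) else x

theorem onCoord_coord (e : Vert → Vert) (v : Vert) : onCoord e (coord v) = coord (e v) := by
  have h : ∃ w, coord w = coord v := ⟨v, rfl⟩
  rw [onCoord, dif_pos h, coord_injective h.choose_spec]

theorem isTreeMap_onCoord {e : tree ≃g tree}
    (he : e (Arboreal.root ratPhi 0) = Arboreal.root ratPhi 0) : IsTreeMap (onCoord e) where
  map_mem n x hx := by
    rw [← coord_mkVert hx, onCoord_coord]
    have h := coord_mem_layer (e (mkVert hx))
    rwa [(depth_map_and_isParent_map he n (mkVert hx) (depth_eq (by rwa [coord_mkVert]))).1] at h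
  phi_map n x hx := by
    have hd : depth (mkVert hx) = n + 1 := depth_eq (by rwa [coord_mkVert])
    obtain ⟨w, hw, -⟩ := exists_isParent hd
    have h := (depth_map_and_isParent_map he _ _ hd).2 w hw
    rw [← coord_mkVert hx, onCoord_coord, (isParent_iff.1 h).1, (isParent_iff.1 hw).1,
      onCoord_coord]
  injOn n x hx y hy h := by
    rw [← coord_mkVert hx, ← coord_mkVert hy, onCoord_coord, onCoord_coord] at h
    have := congrArg coord (e.injective (coord_injective h))
    rwa [coord_mkVert, coord_mkVert] at this

theorem arborealImage_eq_top : Arboreal.arborealImage ratPhi (0 : ℚ) = ⊤ := by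
  rw [Arboreal.arborealImage, MonoidHom.range_eq_top]
  rintro ⟨e, he⟩
  obtain ⟨σ, hσ⟩ := (isTreeMap_onCoord he).exists_algEquiv_eq
  refine ⟨σ, Subtype.ext (RelIso.ext fun v => Subtype.ext ?_)⟩
  change Arboreal.galMap σ v.1 = (e v).1
  rw [coe_coord v, coe_coord (e v), ← onCoord_coord, ← hσ _ _ (coord_mem_layer v)]
  rfl

end QuadraticTree

theorem mainTheorem5 (φ : RatFunc ℚ)
    (hφ : φ = (1 + 3 * RatFunc.X ^ 2) / (1 - 4 * RatFunc.X - RatFunc.X ^ 2)) :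
    ¬ Arboreal.IsConjToPolynomial φ ∧
    (Arboreal.preimageTree φ 0).IsTree ∧
    (∀ v : Arboreal.Vertex φ 0,
      {w : Arboreal.Vertex φ 0 |
        Arboreal.ratMap (AlgebraicClosure ℚ) φ w.1 = v.1}.ncard = 2) ∧
    Arboreal.arborealImage φ 0 = ⊤ := by
  subst hφ
  refine ⟨QuadraticTree.not_isConjToPolynomial, QuadraticTree.tree_isTree, fun v => ?_,
    QuadraticTree.arborealImage_eq_top⟩
  -- the two `ℚ`-algebra structures on the algebraic closure that occur here agree
  rw [Subsingleton.elim (DivisionRing.toRatAlgebra : Algebra ℚ (AlgebraicClosure ℚ))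
    QuadraticTree.qbarAlgebra]
  exact QuadraticTree.ncard_setOf_isParent v
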